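/- Let $K$ be a field, $n\ge 0$, and $A=K[x_1,\dots,x_n,y_1,\dots,y_n]$ with the $\mathbb Z^n$-grading $\deg x_i=\deg y_i=e_i$. For a simple graph $H$ whose vertices lie in $[n]=\{1,\dots,n\}$, let $J_H=\langle x_iy_j-x_jy_i : \{i,j\}\text{ an edge of }H\rangle\subseteq A$ be its binomial edge ideal. For a graph $G$ on $[n]$ and $S\subseteq[n]$, let $G_1,\dots,G_c$ be the connected components of $G\setminus S$, let $\widetilde G_k$ be the complete graph on the vertices of $G_k$, and put $$P_S(G)=\langle x_i,y_i : i\in S\rangle+J_{\widetilde G_1}+\cdots+J_{\widetilde G_c}.$$ Fix a term order $\tau$ on $A$ with $x_i>y_i$ for all $i$. For an ideal $I\subseteq A$, let $\mathrm{gin}(I)$ denote its $\mathbb Z^n$-graded generic initial ideal with respect to $\tau$. That is, if $K$ is infinite, $\mathrm{gin}(I)=\mathrm{in}_\tau(g(I))$ for all $g$ in a nonempty Zariski open subset of $GL_2(K)^n$, where the $i$-th factor acts by linear changes of the coordinates $x_i,y_i$. For arbitrary $K$, $\mathrm{gin}(I)$ is the ideal of $A$ such that, for every infinite extension field $L$ of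 $K$, $\mathrm{gin}(I)L[x,y]=\mathrm{in}_\tau(g(I\,L[x,y]))$ for all $g$ in a nonempty Zariski open subset of $GL_2(L)^n$. Then the generic initial ideals below exist, and the following hold. (i) For every graph $G$ on $[n]$ and every $S\subseteq[n]$, $$\mathrm{gin}(P_S(G))=\langle x_i,y_i : i\in S\rangle+\mathrm{gin}(J_{\widetilde G_1})+\cdots+\mathrm{gin}(J_{\widetilde G_c}),$$ and this is a squarefree monomial ideal of height $n-c+|S|$. (ii) If $1\le t\le n$ and $\widetilde G$ is the complete graph on $\{1,\dots,t\}\subseteq[n]$, then $$\mathrm{gin}(J_{\widetilde G})=\langle x_ix_j : 1\le i<j\le t\rangle=\bigcap_{i=1}^t\langle x_1,\dots,\widehat{x_i},\dots,x_t\rangle .$$ The ideals $\langle x_1,\dots,\widehat{x_i},\dots,x_t\rangle$ are prime, and $\mathrm{gin}(J_{\widetilde G})$ is a squarefree monomial ideal such that the ring $A/\mathrm{gin}(J_{\widetilde G})$ is Cohen–Macaulay. -/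

import Mathlib

open MvPolynomial

universe u v

noncomputable section

namespace BinomialEdge

/-- The polynomial ring `K[x_1, …, x_n, y_1, …, y_n]`. The variable `x_i` is indexed by
`Sum.inl i` and the variable `y_i` by `Sum.inr i`. -/
abbrev PolyRing (n : ℕ) (K : Type u) [Field K] : Type u :=
  MvPolynomial (Fin n ⊕ Fin n) K

/-- The variable `x_i`. -/
def x {n : ℕ} (K : Type u) [Field K] (i : Fin n) : PolyRing n K := X (Sum.inl i)

/-- The variable `y_i`. -/
def y {n : ℕ} (K : Type u) [Field K] (i : Fin n) : PolyRing n K := X (Sum.inr i)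

/-- The binomial edge ideal `J_G`, generated by the minors `x_i y_j - x_j y_i`, where `{i, j}` is
an edge of `G`. -/
def edgeIdeal {n : ℕ} (K : Type u) [Field K] (G : SimpleGraph (Fin n)) : Ideal (PolyRing n K) :=
  Ideal.span {f | ∃ i j, G.Adj i j ∧ f = x K i * y K j - x K j * y K i}

/-- The complete graph on the vertex set `W ⊆ [n]` (the vertices outside `W` are isolated, which
does not affect the binomial edge ideal). -/
def completeOn {n : ℕ} (W : Set (Fin n)) : SimpleGraph (Fin n) where
  Adj i j := i ≠ j ∧ i ∈ W ∧ j ∈ W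
  symm := ⟨fun _ _ h => ⟨h.1.symm, h.2.2, h.2.1⟩⟩
  loopless := ⟨fun _ h => h.1 rfl⟩

/-- The connected components of `G \ S`. -/
abbrev Component {n : ℕ} (G : SimpleGraph (Fin n)) (S : Finset (Fin n)) : Type :=
  (G.induce ((S : Set (Fin n))ᶜ)).ConnectedComponent

/-- The vertices in `[n]` of a connected component of `G \ S`. -/
def componentVerts {n : ℕ} {G : SimpleGraph (Fin n)} {S : Finset (Fin n)}
    (C : Component G S) : Set (Fin n) :=
  Subtype.val '' C.supp

/-- The ideal generated by the variables `x_i, y_i` with `i ∈ S`. -/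
def varIdeal {n : ℕ} (K : Type u) [Field K] (S : Finset (Fin n)) : Ideal (PolyRing n K) :=
  Ideal.span {f | ∃ i ∈ S, f = x K i ∨ f = y K i}

/-- The ideal `P_S(G)`. -/
def primeP {n : ℕ} (K : Type u) [Field K] (G : SimpleGraph (Fin n)) (S : Finset (Fin n)) :
    Ideal (PolyRing n K) :=
  varIdeal K S ⊔ ⨆ C : Component G S, edgeIdeal K (completeOn (componentVerts C))

/-- The initial ideal with respect to a monomial order, generated by the leading terms of all the
elements of the ideal. -/
def initialIdeal {σ : Type*} {R : Type*} [CommRing R] (τ : MonomialOrder σ)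
    (I : Ideal (MvPolynomial σ R)) : Ideal (MvPolynomial σ R) :=
  Ideal.span (τ.leadingTerm '' (I : Set (MvPolynomial σ R)))

/-- The action of `g = (g_1, …, g_n) ∈ GL₂(L)ⁿ` on the polynomial ring: `g_i` acts as a linear
change of coordinates on the span of `x_i, y_i`. These are the `ℤⁿ`-graded coordinate changes for
the grading `deg x_i = deg y_i = e_i`. -/
def coordChange {n : ℕ} {L : Type u} [Field L] (g : Fin n → GL (Fin 2) L) :
    PolyRing n L →ₐ[L] PolyRing n L :=
  aeval (Sum.elim
    (fun i => C ((g i).1 0 0) * x L i + C ((g i).1 1 0) * y L i)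
    (fun i => C ((g i).1 0 1) * x L i + C ((g i).1 1 1) * y L i))

/-- Zariski open subsets of `GL₂(L)ⁿ`: sets on which at least one member of some family of
polynomials in the matrix entries does not vanish. -/
def IsZariskiOpen {n : ℕ} {L : Type u} [Field L] (U : Set (Fin n → GL (Fin 2) L)) : Prop :=
  ∃ F : Set (MvPolynomial (Fin n × Fin 2 × Fin 2) L),
    U = {g | ∃ f ∈ F, eval (fun e => (g e.1).1 e.2.1 e.2.2) f ≠ 0}

/-- Extension of scalars of an ideal along a field extension `L / K`. -/
def extendScalars {n : ℕ} {K : Type u} [Field K] (L : Type u) [Field L] [Algebra K L]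
    (I : Ideal (PolyRing n K)) : Ideal (PolyRing n L) :=
  I.map (MvPolynomial.map (algebraMap K L))

/-- `M` is the `ℤⁿ`-graded generic initial ideal of `I` with respect to `τ`: the initial ideal of
`g(I)` is `M` for all `g` in a nonempty Zariski open set of `ℤⁿ`-graded coordinate changes.
Generic coordinates only make sense over an infinite field, so that this is required over the
infinite extension fields `L` of `K` (with `L = K` among them if `K` is infinite). -/
def IsGin {n : ℕ} {K : Type u} [Field K] (τ : MonomialOrder.{0, v} (Fin n ⊕ Fin n))
    (I M : Ideal (PolyRing n K)) : Prop :=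
  ∀ (L : Type u) [Field L] [Algebra K L] [Infinite L],
    ∃ U : Set (Fin n → GL (Fin 2) L), IsZariskiOpen U ∧ U.Nonempty ∧
      ∀ g ∈ U, initialIdeal τ ((extendScalars L I).map (coordChange g)) = extendScalars L M

open Classical in
/-- The `ℤⁿ`-graded generic initial ideal `gin(I)`: the ideal `M` with `IsGin τ I M` (with the
value `⊥` if there were no such `M`). -/
def gin {n : ℕ} {K : Type u} [Field K] (τ : MonomialOrder.{0, v} (Fin n ⊕ Fin n))
    (I : Ideal (PolyRing n K)) : Ideal (PolyRing n K) :=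
  if h : ∃ M, IsGin τ I M then h.choose else ⊥

/-- Ideals generated by squarefree monomials. -/
def IsSquarefreeMonomialIdeal {σ : Type*} {R : Type*} [CommRing R]
    (I : Ideal (MvPolynomial σ R)) : Prop :=
  ∃ E : Set (σ →₀ ℕ), (∀ e ∈ E, ∀ i, e i ≤ 1) ∧
    I = Ideal.span ((fun e => monomial e (1 : R)) '' E)

/-- The depth of a local ring: the supremum of the lengths of the regular sequences in its maximal
ideal. -/
def localDepth (R : Type*) [CommRing R] [IsLocalRing R] : ℕ∞ :=
  ⨆ rs : {rs : List R // RingTheory.Sequence.IsRegular R rs ∧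
    ∀ r ∈ rs, r ∈ IsLocalRing.maximalIdeal R}, (rs.1.length : ℕ∞)

/-- A Cohen–Macaulay ring: a Noetherian ring whose localizations at maximal ideals have depth equal
to their Krull dimension. -/
def IsCohenMacaulay (R : Type*) [CommRing R] : Prop :=
  IsNoetherianRing R ∧ ∀ (m : Ideal R) [m.IsMaximal],
    (localDepth (Localization.AtPrime m) : WithBot ℕ∞) = ringKrullDim (Localization.AtPrime m)

end BinomialEdge

end

/-! Both families of ideals are of one kind (`binomialIdeal`): a labelling of the vertices is given,
and the generators are the variables indexed by `S` and all minors with equal labels. The genericity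
condition is that the first rows of `g_i` and `g_j` are independent for all `i ≠ j`. The transformed
minor then contains `x_i x_j` with nonzero coefficient, and its other terms arise by replacing some
`x` by the smaller `y`. Hence `x_i x_j` is its leading monomial for every admissible order, and the
initial ideal contains `monomialIdeal`.

For equality, the monomials outside `monomialIdeal` must be independent modulo the transformed ideal
(`eq_zero_of_forall_isStandard`). That ideal vanishes on points which, before the coordinate change,
are proportional within each class. A standard monomial involves at most one `x_k` per class;
centring the parametrization of the class at this `k` makes the image of the monomial have a nonzero
coefficient at a predictable lowest exponent. In a supposed relation, a monomial of least degree
and, among these, of largest `x`-degree has a lowest term that nothing else cancels. Division with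
remainder then gives `initialIdeal_map_coordChange`. Generic initial ideals are unique because
nonempty open sets meet over an infinite field and extension of scalars is injective on ideals.

The height comes from the primes over `monomialIdeal`: each contains one generated by the `x_i` off
a transversal of the classes outside `S` and by the `y_i` with `i ∈ S`. For one clique, the quotient
is a polynomial ring over the coordinate ring of the `t` axes. That ring is integral over `K[θ]`,
where `θ` is the sum of the variables, and monic polynomials in `θ` are nonzerodivisors. This
yields, in every maximal ideal, a regular sequence with quotient integral over `K`, a property which
passes to polynomial rings and forces depth to equal dimension locally. -/

noncomputable section

namespace BinomialEdge

/-! ### Cohen–Macaulayness from regular sequences with integral quotient. -/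

open RingTheory.Sequence

/-- Every maximal ideal of the `K`-algebra `B` contains a weakly regular sequence modulo which `B`
is integral over `K`. -/
def HasRegularParameters (K B : Type*) [Field K] [CommRing B] [Algebra K B] : Prop :=
  ∀ m : Ideal B, m.IsMaximal → ∃ rs : List B, (∀ r ∈ rs, r ∈ m) ∧ IsWeaklyRegular B rs ∧
    Algebra.IsIntegral K (B ⧸ Ideal.ofList rs)

lemma isMaximal_of_isIntegral_quotient {K B : Type*} [Field K] [CommRing B] [Algebra K B]
    {I P : Ideal B} [Algebra.IsIntegral K (B ⧸ I)] [P.IsPrime] (h : I ≤ P) : P.IsMaximal := by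
  have : Algebra.IsIntegral K (B ⧸ P) :=
    Algebra.IsIntegral.of_surjective (Ideal.Quotient.factorₐ K h)
      (Ideal.Quotient.factor_surjective h)
  apply Ideal.Quotient.maximal_of_isField
  exact isField_of_isIntegral_of_isField' (R := K) (Field.toIsField K)

/-- The sequence stays regular in the localization and cuts the dimension down to zero. Since a
regular sequence lowers the dimension by exactly its length, the dimension equals that length, and
no regular sequence can be longer. -/
theorem HasRegularParameters.isCohenMacaulay {K B : Type*} [Field K] [CommRing B] [Algebra K B]
    [IsNoetherianRing B] (h : HasRegularParameters K B) : IsCohenMacaulay B := by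
  refine ⟨inferInstance, fun m hm => ?_⟩
  obtain ⟨rs, hmem, hreg, hint⟩ := h m hm
  set R := Localization.AtPrime m
  have : IsNoetherianRing R := IsLocalization.isNoetherianRing m.primeCompl R inferInstance
  have hR : IsRegular R (rs.map (algebraMap B R)) :=
    hreg.isRegular_of_isLocalization_of_mem R m hmem
  have hmax : ∀ r ∈ rs.map (algebraMap B R), r ∈ IsLocalRing.maximalIdeal R := by
    intro r hr
    obtain ⟨b, hb, rfl⟩ := List.mem_map.mp hr
    exact (IsLocalization.AtPrime.to_map_mem_maximal_iff R m b).mpr (hmem b hb)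
  have hne : Ideal.ofList (rs.map (algebraMap B R)) ≠ ⊤ := by
    intro htop
    exact (IsLocalRing.maximalIdeal.isMaximal R).ne_top
      (top_le_iff.mp (htop ▸ Ideal.span_le.mpr hmax))
  -- A prime of the localization containing the sequence contracts to a prime of `B` with quotient
  -- integral over `K`. The contraction is therefore maximal, so it equals `m`, and the prime is the
  -- maximal ideal.
  have hdim : ringKrullDim (R ⧸ Ideal.ofList (rs.map (algebraMap B R))) = 0 := by
    have : Nontrivial (R ⧸ Ideal.ofList (rs.map (algebraMap B R))) :=
      Ideal.Quotient.nontrivial_iff.mpr hne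
    have : Ring.KrullDimLE 0 (R ⧸ Ideal.ofList (rs.map (algebraMap B R))) := by
      rw [Ring.krullDimLE_zero_iff]
      intro Q hQ
      set Q' := Q.comap (Ideal.Quotient.mk (Ideal.ofList (rs.map (algebraMap B R)))) with hQ'
      have hQ'p : Q'.IsPrime := Ideal.comap_isPrime _ _
      have hle : Ideal.ofList (rs.map (algebraMap B R)) ≤ Q' := by
        intro z hz
        rw [hQ', Ideal.mem_comap, Ideal.Quotient.eq_zero_iff_mem.mpr hz]
        exact Q.zero_mem
      have hle' : Ideal.ofList rs ≤ Q'.comap (algebraMap B R) := by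
        rw [← Ideal.map_le_iff_le_comap, Ideal.map_ofList]
        exact hle
      have hP : (Q'.comap (algebraMap B R)).IsMaximal :=
        isMaximal_of_isIntegral_quotient (K := K) hle'
      have hmR : (IsLocalRing.maximalIdeal R).comap (algebraMap B R) = m :=
        IsLocalization.AtPrime.under_maximalIdeal R m
      have hPm : Q'.comap (algebraMap B R) = m := by
        refine hP.eq_of_le hm.ne_top ?_
        refine le_trans ?_ hmR.le
        exact Ideal.comap_mono (IsLocalRing.le_maximalIdeal hQ'p.ne_top)
      have hQm : Q' = IsLocalRing.maximalIdeal R := by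
        rw [← IsLocalization.map_under m.primeCompl R Q',
          ← IsLocalization.map_under m.primeCompl R (IsLocalRing.maximalIdeal R)]
        exact congrArg _ (hPm.trans hmR.symm)
      have : Q'.IsMaximal := hQm ▸ inferInstance
      have := Ideal.map_eq_top_or_isMaximal_of_surjective
        (Ideal.Quotient.mk (Ideal.ofList (rs.map (algebraMap B R))))
        Ideal.Quotient.mk_surjective this
      rw [hQ', Ideal.map_comap_of_surjective _ Ideal.Quotient.mk_surjective] at this
      exact this.resolve_left hQ.ne_top
    exact ringKrullDimZero_iff_ringKrullDim_eq_zero.mp this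
  have hlen : ringKrullDim R = (rs.map (algebraMap B R)).length := by
    rw [← ringKrullDim_add_length_eq_ringKrullDim_of_isRegular _ hR, hdim, zero_add]
  have hdepth : localDepth R = (rs.map (algebraMap B R)).length := by
    apply le_antisymm
    · refine iSup_le fun ⟨rs', hrs', hrs'm⟩ => ?_
      have h1 := ringKrullDim_add_length_eq_ringKrullDim_of_isRegular _ hrs'
      have hne' : Nontrivial (R ⧸ Ideal.ofList rs') := by
        rw [Ideal.Quotient.nontrivial_iff]
        intro htop
        exact (IsLocalRing.maximalIdeal.isMaximal R).ne_top
          (top_le_iff.mp (htop ▸ Ideal.span_le.mpr hrs'm))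
      have h2 : (0 : WithBot ℕ∞) ≤ ringKrullDim (R ⧸ Ideal.ofList rs') :=
        ringKrullDim_nonneg_of_nontrivial
      have h3 : ((rs'.length : ℕ∞) : WithBot ℕ∞) ≤ ((rs.map (algebraMap B R)).length : ℕ∞) := by
        have := add_le_add_left h2 (rs'.length : WithBot ℕ∞)
        rw [h1, hlen, zero_add] at this
        exact_mod_cast this
      exact_mod_cast h3
    · exact le_iSup (fun rs : {rs : List R // IsRegular R rs ∧
        ∀ r ∈ rs, r ∈ IsLocalRing.maximalIdeal R} => (rs.1.length : ℕ∞)) ⟨_, hR, hmax⟩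
  rw [hdepth, hlen]
  rfl

lemma HasRegularParameters.of_algEquiv {K B B' : Type*} [Field K] [CommRing B] [Algebra K B]
    [CommRing B'] [Algebra K B'] (e : B ≃ₐ[K] B') (h : HasRegularParameters K B) :
    HasRegularParameters K B' := by
  intro m hm
  obtain ⟨rs, hmem, hreg, hint⟩ := h (m.comap e) (Ideal.comap_isMaximal_of_equiv e)
  refine ⟨rs.map e, ?_, ?_, ?_⟩
  · intro r hr
    obtain ⟨b, hb, rfl⟩ := List.mem_map.mp hr
    exact hmem b hb
  · refine (AddEquiv.isWeaklyRegular_congr (e := e.toRingEquiv.toAddEquiv) ?_).mp hreg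
    rw [List.forall₂_map_right_iff, List.forall₂_same]
    intro r _ b
    simp
  · exact Algebra.IsIntegral.of_surjective
      (Ideal.quotientEquivAlg (Ideal.ofList rs) (Ideal.ofList (rs.map e)) e
        (Ideal.map_ofList (e : B →+* B') rs).symm).toAlgHom (AlgEquiv.surjective _)

/-- An element of a finitely generated algebra satisfies a monic equation modulo any maximal
ideal. -/
lemma exists_monic_aeval_mem {K B : Type*} [Field K] [CommRing B] [Algebra K B]
    [Algebra.FiniteType K B] (m : Ideal B) [hm : m.IsMaximal] (b : B) :
    ∃ f : Polynomial K, f.Monic ∧ Polynomial.aeval b f ∈ m := by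
  -- Zariski's lemma: the residue field is finite over `K`.
  let := Ideal.Quotient.field m
  have : Module.Finite K (B ⧸ m) := finite_of_finite_type_of_isJacobsonRing K (B ⧸ m)
  obtain ⟨f, hf, h⟩ := Algebra.IsIntegral.isIntegral (R := K) (Ideal.Quotient.mk m b)
  refine ⟨f, hf, ?_⟩
  rw [← Ideal.Quotient.eq_zero_iff_mem, ← h, ← Polynomial.aeval_def]
  exact (Polynomial.aeval_algHom_apply (Ideal.Quotient.mkₐ K m) b f).symm

lemma mem_map_C_of_monic_mul_mem {B : Type*} [CommRing B] {I : Ideal B} {f p : Polynomial B}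
    (hf : f.Monic) (h : f * p ∈ I.map Polynomial.C) : p ∈ I.map Polynomial.C := by
  have hker : RingHom.ker (Polynomial.mapRingHom (Ideal.Quotient.mk I)) = I.map Polynomial.C := by
    rw [Polynomial.ker_mapRingHom, Ideal.mk_ker]
  rw [← hker, RingHom.mem_ker, map_mul] at h
  rw [← hker, RingHom.mem_ker]
  exact ((hf.map (Ideal.Quotient.mk I)).mul_right_eq_zero_iff).mp h

/-- A maximal ideal of `B[X]` contracts to a maximal ideal because `B` is Jacobson. The sequence for
the contraction is extended by a monic polynomial in `X` over `K`: being monic it is regular modulo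
any ideal extended from `B`, and it makes `X` integral. -/
lemma HasRegularParameters.polynomial {K B : Type*} [Field K] [CommRing B] [Algebra K B]
    [Algebra.FiniteType K B] (h : HasRegularParameters K B) :
    HasRegularParameters K (Polynomial B) := by
  intro m hm
  have : IsJacobsonRing B := isJacobsonRing_of_finiteType (A := K)
  have hmC : (m.comap Polynomial.C).IsMaximal :=
    Polynomial.isMaximal_comap_C_of_isJacobsonRing m
  obtain ⟨rs, hmem, hreg, hint⟩ := h _ hmC
  obtain ⟨f, hf, hfm⟩ := exists_monic_aeval_mem (K := K) m Polynomial.X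
  have hfX : Polynomial.aeval (Polynomial.X : Polynomial B) f = f.map (algebraMap K B) :=
    (Polynomial.eval₂_map (algebraMap K B) Polynomial.C Polynomial.X).symm.trans
      Polynomial.eval₂_C_X
  rw [hfX] at hfm
  refine ⟨rs.map Polynomial.C ++ [f.map (algebraMap K B)], ?_, ?_, ?_⟩
  · intro r hr
    rcases List.mem_append.mp hr with hr | hr
    · obtain ⟨b, hb, rfl⟩ := List.mem_map.mp hr
      exact hmem b hb
    · rw [List.mem_singleton.mp hr]
      exact hfm
  · rw [isWeaklyRegular_append_iff]
    refine ⟨hreg.of_flat (S := Polynomial B), ?_⟩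
    rw [isWeaklyRegular_singleton_iff, isSMulRegular_iff_right_eq_zero_of_smul]
    intro z hz
    induction z using Submodule.Quotient.induction_on with | _ p
    rw [← Submodule.Quotient.mk_smul, Submodule.Quotient.mk_eq_zero] at hz
    rw [Submodule.Quotient.mk_eq_zero]
    simp only [smul_eq_mul, Ideal.mul_top, ← Ideal.map_ofList] at hz ⊢
    exact mem_map_C_of_monic_mul_mem (hf.map _) hz
  · set J := Ideal.ofList (rs.map Polynomial.C ++ [f.map (algebraMap K B)]) with hJ
    have hX : IsIntegral K (Ideal.Quotient.mk J Polynomial.X) := by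
      refine ⟨f, hf, ?_⟩
      rw [← Polynomial.aeval_def]
      have := Polynomial.aeval_algHom_apply (Ideal.Quotient.mkₐ K J) Polynomial.X f
      rw [hfX] at this
      refine this.trans (Ideal.Quotient.eq_zero_iff_mem.mpr ?_)
      exact Ideal.subset_span (by simp)
    have hC : ∀ b : B, IsIntegral K (Ideal.Quotient.mk J (Polynomial.C b)) := by
      intro b
      have hle : Ideal.ofList rs ≤ J.comap (Polynomial.CAlgHom (R := K) (A := B)) := by
        refine Ideal.span_le.mpr fun r hr => Ideal.subset_span ?_
        exact List.mem_append_left _ (List.mem_map_of_mem hr)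
      exact (Algebra.IsIntegral.isIntegral (R := K)
        (Ideal.Quotient.mk (Ideal.ofList rs) b)).map (Ideal.quotientMapₐ J Polynomial.CAlgHom hle)
    refine ⟨fun z => ?_⟩
    obtain ⟨p, rfl⟩ := Ideal.Quotient.mk_surjective z
    induction p using Polynomial.induction_on' with
    | add p q hp hq => rw [map_add]; exact hp.add hq
    | monomial k b =>
      rw [← Polynomial.C_mul_X_pow_eq_monomial, map_mul, map_pow]
      exact (hC b).mul (hX.pow k)

lemma HasRegularParameters.mvPolynomial_fin {K B : Type*} [Field K] [CommRing B] [Algebra K B]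
    [Algebra.FiniteType K B] (h : HasRegularParameters K B) (p : ℕ) :
    HasRegularParameters K (MvPolynomial (Fin p) B) := by
  induction p with
  | zero => exact h.of_algEquiv ((MvPolynomial.isEmptyAlgEquiv B (Fin 0)).restrictScalars K).symm
  | succ p ih => exact ih.polynomial.of_algEquiv ((finSuccEquiv B p).restrictScalars K).symm

lemma HasRegularParameters.mvPolynomial {K B ρ : Type*} [Finite ρ] [Field K] [CommRing B]
    [Algebra K B] [Algebra.FiniteType K B] (h : HasRegularParameters K B) :
    HasRegularParameters K (MvPolynomial ρ B) := by
  obtain ⟨p, ⟨e⟩⟩ := Finite.exists_equiv_fin ρ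
  exact (h.mvPolynomial_fin p).of_algEquiv ((renameEquiv B e.symm).restrictScalars K)

/-! ### Ideals generated by variables and the union of coordinate axes. -/

section VariableIdeals

variable {σ K : Type*} [Field K]

open Classical in
/-- The endomorphism of the polynomial ring that sends the variables in `T` to zero and fixes the
other ones. -/
def killVars (K : Type*) [Field K] (T : Set σ) : MvPolynomial σ K →ₐ[K] MvPolynomial σ K :=
  aeval fun s => if s ∈ T then 0 else X s

lemma ker_killVars (T : Set σ) :
    RingHom.ker (killVars K T) = Ideal.span (X '' T : Set (MvPolynomial σ K)) := by
  apply le_antisymm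
  · intro f hf
    have h : (Ideal.Quotient.mkₐ K (Ideal.span (X '' T))).comp (killVars K T) =
        Ideal.Quotient.mkₐ K (Ideal.span (X '' T)) := by
      ext s
      by_cases hs : s ∈ T
      · simpa [killVars, hs] using
          (Ideal.Quotient.eq_zero_iff_mem.mpr (Ideal.subset_span (Set.mem_image_of_mem X hs))).symm
      · simp [killVars, hs]
    have hf' := DFunLike.congr_fun h f
    rw [AlgHom.comp_apply, (RingHom.mem_ker).mp hf, map_zero] at hf'
    exact Ideal.Quotient.eq_zero_iff_mem.mp hf'.symm
  · rw [Ideal.span_le]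
    rintro _ ⟨s, hs, rfl⟩
    simp [killVars, hs]

lemma isPrime_span_X_image (T : Set σ) :
    (Ideal.span (X '' T : Set (MvPolynomial σ K))).IsPrime := by
  rw [← ker_killVars]
  exact RingHom.ker_isPrime _

lemma X_mem_span_X_image {T : Set σ} {s : σ} :
    (X s : MvPolynomial σ K) ∈ Ideal.span (X '' T) ↔ s ∈ T := by
  rw [← ker_killVars, RingHom.mem_ker]
  by_cases hs : s ∈ T <;> simp [killVars, hs]

theorem height_span_X_image [Finite σ] (T : Finset σ) :
    (Ideal.span (X '' (T : Set σ) : Set (MvPolynomial σ K))).height = T.card := by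
  classical
  apply le_antisymm
  · have := isPrime_span_X_image (K := K) (T : Set σ)
    have h := Ideal.height_le_card_of_mem_minimalPrimes_span_finset (R := MvPolynomial σ K)
      (p := Ideal.span (X '' (T : Set σ))) (s := T.image X)
      (by rw [Finset.coe_image, Ideal.minimalPrimes_eq_subsingleton_self]; rfl)
    exact h.trans (by exact_mod_cast Finset.card_image_le)
  · induction T using Finset.induction_on with
    | empty => simp
    | insert s T hs ih =>
      have h₁ := isPrime_span_X_image (K := K) (T : Set σ)
      have h₂ := isPrime_span_X_image (K := K) ((insert s T : Finset σ) : Set σ)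
      rw [Finset.card_insert_of_notMem hs, Nat.cast_add, Nat.cast_one]
      refine (add_le_add_left ih 1).trans (Ideal.height_add_one_le_of_lt_of_isPrime ?_)
      refine lt_of_le_of_ne (Ideal.span_mono (Set.image_mono (by simp))) fun h => hs ?_
      have : (X s : MvPolynomial σ K) ∈ Ideal.span (X '' (T : Set σ)) := by
        rw [h, X_mem_span_X_image]
        simp
      simpa [X_mem_span_X_image] using this

/-- The ideal of the union of the coordinate axes in the directions of `T`. -/
def axesIdeal (K : Type*) [Field K] (T : Set σ) : Ideal (MvPolynomial σ K) :=
  Ideal.span {f | ∃ i ∈ T, ∃ j ∈ T, i ≠ j ∧ f = X i * X j}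

lemma axesIdeal_eq_span_monomial (T : Set σ) :
    axesIdeal K T = Ideal.span ((fun e => monomial e (1 : K)) ''
      {e | ∃ i ∈ T, ∃ j ∈ T, i ≠ j ∧ e = Finsupp.single i 1 + Finsupp.single j 1}) := by
  rw [axesIdeal]
  congr 1
  ext f
  constructor
  · rintro ⟨i, hi, j, hj, hij, rfl⟩
    exact ⟨_, ⟨i, hi, j, hj, hij, rfl⟩, by simp [X, monomial_mul]⟩
  · rintro ⟨_, ⟨i, hi, j, hj, hij, rfl⟩, rfl⟩
    exact ⟨i, hi, j, hj, hij, by simp [X, monomial_mul]⟩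

/-- A monomial in the intersection involves, for each `i ∈ T`, a variable of `T` other than `i`;
using this twice produces two distinct ones. For empty `T` the intersection would be the unit ideal.
-/
theorem axesIdeal_eq_iInf {T : Set σ} (hT : T.Nonempty) :
    axesIdeal K T = ⨅ i : T, Ideal.span (X '' (T \ {i.1})) := by
  apply le_antisymm
  · refine le_iInf fun i => Ideal.span_le.mpr ?_
    rintro _ ⟨j, hj, k, hk, hjk, rfl⟩
    by_cases hji : j = i
    · exact Ideal.mul_mem_left _ _ (X_mem_span_X_image.mpr ⟨hk, fun h => hjk (hji.trans h.symm)⟩)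
    · exact Ideal.mul_mem_right _ _ (X_mem_span_X_image.mpr ⟨hj, hji⟩)
  · classical
    intro f hf
    rw [axesIdeal_eq_span_monomial, mem_ideal_span_monomial_image]
    intro e he
    have key : ∀ i ∈ T, ∃ j ∈ T, j ≠ i ∧ e j ≠ 0 := by
      intro i hi
      obtain ⟨j, hj, hje⟩ := mem_ideal_span_X_image.mp ((Ideal.mem_iInf.mp hf) ⟨i, hi⟩) e he
      exact ⟨j, hj.1, hj.2, hje⟩
    obtain ⟨i₀, hi₀⟩ := hT
    obtain ⟨i, hi, -, hie⟩ := key i₀ hi₀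
    obtain ⟨j, hj, hji, hje⟩ := key i hi
    refine ⟨_, ⟨j, hj, i, hi, hji, rfl⟩, fun s => ?_⟩
    rw [Finsupp.add_apply, Finsupp.single_apply, Finsupp.single_apply]
    split_ifs with h₁ h₂ h₂
    · exact absurd (h₁.trans h₂.symm) hji
    · subst h₁; omega
    · subst h₂; omega
    · omega

/-- Modulo the prime of the `i`-th axis the sum of the variables becomes `X i`, which is
transcendental, so `f` of the sum lies in none of the primes whose intersection is the axes ideal.
-/
lemma smulRegular_axes [Fintype σ] [Nonempty σ] {f : Polynomial K} (hf : f.Monic) :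
    IsSMulRegular (MvPolynomial σ K ⧸ axesIdeal K (Set.univ : Set σ))
      (Polynomial.aeval (Ideal.Quotient.mk (axesIdeal K (Set.univ : Set σ)) (∑ i, X i)) f) := by
  classical
  have hmk : Polynomial.aeval (Ideal.Quotient.mk (axesIdeal K (Set.univ : Set σ)) (∑ i, X i)) f =
      Ideal.Quotient.mk _ (Polynomial.aeval (∑ i, X i : MvPolynomial σ K) f) :=
    Polynomial.aeval_algHom_apply (Ideal.Quotient.mkₐ K _) (∑ i, X i) f
  rw [hmk, isSMulRegular_iff_right_eq_zero_of_smul]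
  intro z hz
  obtain ⟨p, rfl⟩ := Ideal.Quotient.mk_surjective z
  rw [smul_eq_mul, ← map_mul, Ideal.Quotient.eq_zero_iff_mem,
    axesIdeal_eq_iInf Set.univ_nonempty, Ideal.mem_iInf] at hz
  rw [Ideal.Quotient.eq_zero_iff_mem, axesIdeal_eq_iInf Set.univ_nonempty, Ideal.mem_iInf]
  intro i
  refine ((isPrime_span_X_image _).mem_or_mem (hz i)).resolve_left fun h => ?_
  rw [← ker_killVars, RingHom.mem_ker, ← Polynomial.aeval_algHom_apply] at h
  have hsum : killVars K (Set.univ \ {i.1}) (∑ j, X j) = X i.1 := by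
    rw [map_sum, Finset.sum_eq_single i.1]
    · simp [killVars]
    · intro j _ hj
      simp [killVars, hj]
    · simp
  rw [hsum] at h
  exact hf.ne_zero ((transcendental_iff.mp (transcendental_X K i.1)) f h)

/-- Since distinct variables multiply to zero, each variable is a root of `X (X - θ)`, with `θ`
their sum. Integrality is transitive through the integral closure, which contains `θ`. -/
lemma isIntegral_of_sum_isIntegral [Fintype σ] {B : Type*} [CommRing B] [Algebra K B]
    (φ : MvPolynomial σ K →ₐ[K] B) (hφ : Function.Surjective φ)
    (hmul : ∀ i j, i ≠ j → φ (X i) * φ (X j) = 0) (hθ : IsIntegral K (∑ i, φ (X i))) :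
    Algebra.IsIntegral K B := by
  classical
  have hX : ∀ i, IsIntegral K (φ (X i)) := by
    intro i
    have h0 : φ (X i) * (φ (X i) - ∑ j, φ (X j)) = 0 := by
      rw [← Finset.add_sum_erase _ _ (Finset.mem_univ i), sub_add_cancel_left, mul_neg,
        Finset.mul_sum, neg_eq_zero]
      exact Finset.sum_eq_zero fun j hj => hmul i j (Finset.ne_of_mem_erase hj).symm
    let c : integralClosure K B := ⟨∑ j, φ (X j), hθ⟩
    refine isIntegral_trans (A := integralClosure K B) _
      ⟨Polynomial.X * (Polynomial.X - Polynomial.C c),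
        Polynomial.monic_X.mul (Polynomial.monic_X_sub_C c), ?_⟩
    rw [Polynomial.eval₂_mul, Polynomial.eval₂_sub, Polynomial.eval₂_X, Polynomial.eval₂_C]
    exact h0
  refine ⟨fun z => ?_⟩
  obtain ⟨p, rfl⟩ := hφ z
  induction p using MvPolynomial.induction_on with
  | C a => exact φ.commutes a ▸ isIntegral_algebraMap
  | add p q hp hq => rw [map_add]; exact hp.add hq
  | mul_X p i hp => rw [map_mul]; exact hp.mul (hX i)

lemma hasRegularParameters_of_mul_eq_zero [Fintype σ] {B : Type*} [CommRing B] [Algebra K B]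
    (φ : MvPolynomial σ K →ₐ[K] B) (hφ : Function.Surjective φ)
    (hmul : ∀ i j, i ≠ j → φ (X i) * φ (X j) = 0)
    (hreg : ∀ f : Polynomial K, f.Monic → IsSMulRegular B (Polynomial.aeval (∑ i, φ (X i)) f)) :
    HasRegularParameters K B := by
  have : Algebra.FiniteType K B := Algebra.FiniteType.of_surjective φ hφ
  intro m hm
  obtain ⟨f, hf, hfm⟩ := exists_monic_aeval_mem (K := K) m (∑ i, φ (X i))
  refine ⟨[Polynomial.aeval (∑ i, φ (X i)) f], by simpa using hfm, ?_, ?_⟩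
  · rw [isWeaklyRegular_singleton_iff]
    exact hreg f hf
  · set J := Ideal.ofList [Polynomial.aeval (∑ i, φ (X i)) f] with hJ
    refine isIntegral_of_sum_isIntegral ((Ideal.Quotient.mkₐ K J).comp φ)
      ((Ideal.Quotient.mkₐ_surjective K J).comp hφ) ?_ ⟨f, hf, ?_⟩
    · intro i j hij
      rw [AlgHom.comp_apply, AlgHom.comp_apply, ← map_mul, hmul i j hij, map_zero]
    · simp only [AlgHom.comp_apply]
      rw [← Polynomial.aeval_def, ← map_sum, Polynomial.aeval_algHom_apply]
      exact Ideal.Quotient.eq_zero_iff_mem.mpr (Ideal.subset_span (by simp))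

theorem hasRegularParameters_axes [Finite σ] [Nonempty σ] :
    HasRegularParameters K (MvPolynomial σ K ⧸ axesIdeal K (Set.univ : Set σ)) := by
  have := Fintype.ofFinite σ
  refine hasRegularParameters_of_mul_eq_zero (Ideal.Quotient.mkₐ K _)
    (Ideal.Quotient.mkₐ_surjective K _) ?_ ?_
  · intro i j hij
    rw [← map_mul]
    exact Ideal.Quotient.eq_zero_iff_mem.mpr
      (Ideal.subset_span ⟨i, trivial, j, trivial, hij, rfl⟩)
  · intro f hf
    rw [← map_sum]
    exact smulRegular_axes hf

/-- The variables outside `T` are polynomial variables of the coordinate ring of the axes. -/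
theorem isCohenMacaulay_quotient_axesIdeal [Finite σ] {T : Set σ} (hT : T.Nonempty) :
    IsCohenMacaulay (MvPolynomial σ K ⧸ axesIdeal K T) := by
  classical
  have : Nonempty T := hT.to_subtype
  let e : MvPolynomial σ K ≃ₐ[K] MvPolynomial (Tᶜ : Set σ) (MvPolynomial T K) :=
    (renameEquiv K ((Equiv.Set.sumCompl T).symm.trans (Equiv.sumComm _ _))).trans
      (sumAlgEquiv K _ _)
  have he : ∀ i (hi : i ∈ T), e (X i) = C (X ⟨i, hi⟩) := by
    intro i hi
    simp [e, Equiv.Set.sumCompl_symm_apply_of_mem hi]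
  have hmap : (axesIdeal K (Set.univ : Set T)).map (C : _ →+* MvPolynomial (Tᶜ : Set σ) _) =
      (axesIdeal K T).map (e : MvPolynomial σ K →+* _) := by
    rw [axesIdeal, axesIdeal, Ideal.map_span, Ideal.map_span]
    congr 1
    ext f
    constructor
    · rintro ⟨_, ⟨i, -, j, -, hij, rfl⟩, rfl⟩
      refine ⟨_, ⟨i, i.2, j, j.2, fun h => hij (Subtype.ext h), rfl⟩, ?_⟩
      simp [he]
    · rintro ⟨_, ⟨i, hi, j, hj, hij, rfl⟩, rfl⟩
      refine ⟨_, ⟨⟨i, hi⟩, trivial, ⟨j, hj⟩, trivial, fun h => hij (congrArg Subtype.val h), rfl⟩, ?_⟩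
      simp [he i hi, he j hj]
  have h := (hasRegularParameters_axes (K := K) (σ := T)).mvPolynomial (ρ := (Tᶜ : Set σ))
  refine (h.of_algEquiv ?_).isCohenMacaulay (K := K)
  exact ((MvPolynomial.quotientEquivQuotientMvPolynomial (σ := (Tᶜ : Set σ))
    (axesIdeal K (Set.univ : Set T))).restrictScalars K).trans
      (Ideal.quotientEquivAlg (axesIdeal K T) _ e hmap).symm

end VariableIdeals

/-! ### Generic coordinates: leading monomials and a parametrization. -/

section Generic

variable {n : ℕ} {ι : Type*}

/-- The ideal generated by the variables `x_i, y_i` with `i ∈ S` and by the minors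
`x_i y_j - x_j y_i` for all `i, j` with the same label. -/
def binomialIdeal (K : Type u) [Field K] (S : Finset (Fin n)) (κ : Fin n → ι) :
    Ideal (PolyRing n K) :=
  varIdeal K S ⊔ Ideal.span {f | ∃ i j, i ≠ j ∧ κ i = κ j ∧ f = x K i * y K j - x K j * y K i}

/-- The ideal generated by the variables `x_i, y_i` with `i ∈ S` and by the monomials
`x_i x_j` for all `i ≠ j` with the same label. -/
def monomialIdeal (K : Type u) [Field K] (S : Finset (Fin n)) (κ : Fin n → ι) :
    Ideal (PolyRing n K) :=
  varIdeal K S ⊔ Ideal.span {f | ∃ i j, i ≠ j ∧ κ i = κ j ∧ f = x K i * x K j}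

/-- The exponents of the generators of `monomialIdeal`. -/
def monomialExponents (S : Finset (Fin n)) (κ : Fin n → ι) : Set (Fin n ⊕ Fin n →₀ ℕ) :=
  {e | (∃ i ∈ S, e = Finsupp.single (Sum.inl i) 1 ∨ e = Finsupp.single (Sum.inr i) 1) ∨
    ∃ i j, i ≠ j ∧ κ i = κ j ∧ e = Finsupp.single (Sum.inl i) 1 + Finsupp.single (Sum.inl j) 1}

lemma monomialIdeal_eq_span (K : Type u) [Field K] (S : Finset (Fin n)) (κ : Fin n → ι) :
    monomialIdeal K S κ =
      Ideal.span ((fun e => monomial e (1 : K)) '' monomialExponents S κ) := by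
  rw [monomialIdeal, varIdeal, ← Ideal.span_union]
  congr 1
  ext f
  constructor
  · rintro (⟨i, hi, rfl | rfl⟩ | ⟨i, j, hij, hκ, rfl⟩)
    · exact ⟨_, Or.inl ⟨i, hi, Or.inl rfl⟩, rfl⟩
    · exact ⟨_, Or.inl ⟨i, hi, Or.inr rfl⟩, rfl⟩
    · exact ⟨_, Or.inr ⟨i, j, hij, hκ, rfl⟩, by simp [x, X, monomial_mul]⟩
  · rintro ⟨_, ⟨i, hi, rfl | rfl⟩ | ⟨i, j, hij, hκ, rfl⟩, rfl⟩
    · exact Or.inl ⟨i, hi, Or.inl rfl⟩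
    · exact Or.inl ⟨i, hi, Or.inr rfl⟩
    · exact Or.inr ⟨i, j, hij, hκ, by simp [x, X, monomial_mul]⟩

lemma isSquarefreeMonomialIdeal_monomialIdeal (K : Type u) [Field K] (S : Finset (Fin n))
    (κ : Fin n → ι) : IsSquarefreeMonomialIdeal (monomialIdeal K S κ) := by
  refine ⟨_, ?_, monomialIdeal_eq_span K S κ⟩
  rintro e (⟨i, -, rfl | rfl⟩ | ⟨i, j, hij, -, rfl⟩) s
  · rw [Finsupp.single_apply]; split_ifs <;> omega
  · rw [Finsupp.single_apply]; split_ifs <;> omega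
  · rw [Finsupp.add_apply, Finsupp.single_apply, Finsupp.single_apply]
    split_ifs with h₁ h₂
    · exact absurd (Sum.inl_injective (h₁.trans h₂.symm)) hij
    all_goals omega

variable {L : Type u} [Field L]

/-- The determinant of the first rows of `g_i` and `g_j`. -/
def rowMinor (g : Fin n → GL (Fin 2) L) (i j : Fin n) : L :=
  (g i).1 0 0 * (g j).1 0 1 - (g j).1 0 0 * (g i).1 0 1

lemma coordChange_x (g : Fin n → GL (Fin 2) L) (i : Fin n) :
    coordChange g (x L i) = C ((g i).1 0 0) * x L i + C ((g i).1 1 0) * y L i := by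
  simp [coordChange, x]

lemma coordChange_y (g : Fin n → GL (Fin 2) L) (i : Fin n) :
    coordChange g (y L i) = C ((g i).1 0 1) * x L i + C ((g i).1 1 1) * y L i := by
  simp [coordChange, y]

lemma coordChange_minor (g : Fin n → GL (Fin 2) L) (i j : Fin n) :
    coordChange g (x L i * y L j - x L j * y L i) =
      monomial (Finsupp.single (Sum.inl i) 1 + Finsupp.single (Sum.inl j) 1) (rowMinor g i j) +
      (monomial (Finsupp.single (Sum.inl i) 1 + Finsupp.single (Sum.inr j) 1)
        ((g i).1 0 0 * (g j).1 1 1 - (g j).1 1 0 * (g i).1 0 1) +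
      (monomial (Finsupp.single (Sum.inr i) 1 + Finsupp.single (Sum.inl j) 1)
        ((g i).1 1 0 * (g j).1 0 1 - (g j).1 0 0 * (g i).1 1 1) +
      monomial (Finsupp.single (Sum.inr i) 1 + Finsupp.single (Sum.inr j) 1)
        ((g i).1 1 0 * (g j).1 1 1 - (g j).1 1 0 * (g i).1 1 1))) := by
  have key : ∀ (s t : Fin n ⊕ Fin n) (c : L),
      monomial (Finsupp.single s 1 + Finsupp.single t 1) c = C c * (X s * X t) := by
    intro s t c
    simp [X, monomial_mul, C_mul_monomial]
  simp only [map_sub, map_mul, coordChange_x, coordChange_y, key, rowMinor]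
  simp only [x, y]
  ring

variable (τ : MonomialOrder.{0, v} (Fin n ⊕ Fin n))

lemma degree_coordChange_minor
    (hτ : ∀ i : Fin n, τ.toSyn (Finsupp.single (Sum.inr i) 1) <
      τ.toSyn (Finsupp.single (Sum.inl i) 1))
    {g : Fin n → GL (Fin 2) L} {i j : Fin n} (hg : rowMinor g i j ≠ 0) :
    τ.degree (coordChange g (x L i * y L j - x L j * y L i)) =
      Finsupp.single (Sum.inl i) 1 + Finsupp.single (Sum.inl j) 1 := by
  classical
  rw [coordChange_minor]
  have hd : τ.degree (monomial (Finsupp.single (Sum.inl i) 1 + Finsupp.single (Sum.inl j) 1)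
      (rowMinor g i j)) = Finsupp.single (Sum.inl i) 1 + Finsupp.single (Sum.inl j) 1 := by
    rw [τ.degree_monomial, if_neg hg]
  rw [τ.degree_add_of_lt, hd]
  rw [hd]
  refine lt_of_le_of_lt τ.degree_add_le (max_lt ?_
    (lt_of_le_of_lt τ.degree_add_le (max_lt ?_ ?_)))
  all_goals refine lt_of_le_of_lt (τ.degree_monomial_le _) ?_
  all_goals rw [map_add, map_add]
  · exact add_lt_add_right (hτ j) _
  · exact add_lt_add_left (hτ i) _
  · exact add_lt_add (hτ i) (hτ j)

/-- The parametrization adapted to the coordinate change `g` and to a choice of representatives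
`r`: it sends `x_i` to `z_i (d_i s - c_i t)` and `y_i` to `z_i (a_i t - b_i s)`, where
`s = a_k + c_k u_k`, `t = b_k + d_k u_k` for `k = r i`. -/
def parametrization (S : Finset (Fin n)) (g : Fin n → GL (Fin 2) L) (r : Fin n → Fin n) :
    PolyRing n L →ₐ[L] PolyRing n L :=
  aeval (Sum.elim
    (fun i => if i ∈ S then 0 else x L i *
      (C ((g i).1 1 1) * (C ((g (r i)).1 0 0) + C ((g (r i)).1 1 0) * y L (r i)) -
        C ((g i).1 1 0) * (C ((g (r i)).1 0 1) + C ((g (r i)).1 1 1) * y L (r i))))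
    (fun i => if i ∈ S then 0 else x L i *
      (C ((g i).1 0 0) * (C ((g (r i)).1 0 1) + C ((g (r i)).1 1 1) * y L (r i)) -
        C ((g i).1 0 1) * (C ((g (r i)).1 0 0) + C ((g (r i)).1 1 0) * y L (r i)))))

variable {S : Finset (Fin n)} {κ : Fin n → ι} {g : Fin n → GL (Fin 2) L} {r : Fin n → Fin n}

lemma parametrization_x (i : Fin n) : parametrization S g r (x L i) = if i ∈ S then 0 else x L i *
      (C ((g i).1 1 1) * (C ((g (r i)).1 0 0) + C ((g (r i)).1 1 0) * y L (r i)) -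
        C ((g i).1 1 0) * (C ((g (r i)).1 0 1) + C ((g (r i)).1 1 1) * y L (r i))) := by
  simp [parametrization, x]

lemma parametrization_y (i : Fin n) : parametrization S g r (y L i) = if i ∈ S then 0 else x L i *
      (C ((g i).1 0 0) * (C ((g (r i)).1 0 1) + C ((g (r i)).1 1 1) * y L (r i)) -
        C ((g i).1 0 1) * (C ((g (r i)).1 0 0) + C ((g (r i)).1 1 0) * y L (r i))) := by
  simp [parametrization, y]

/-- Up to the factor `det g_i`, the parametrization undoes `g_i`: for `i ∉ S` the composite sends
`x_i, y_i` to `det g_i` times `z_i s, z_i t`. Here `s, t` depend only on `r i`, hence are shared by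
vertices with equal labels, so the minors vanish. -/
lemma parametrization_eq_zero (hr : ∀ i j, κ i = κ j → r i = r j) {f : PolyRing n L}
    (hf : f ∈ (binomialIdeal L S κ).map (coordChange g)) : parametrization S g r f = 0 := by
  have : (binomialIdeal L S κ).map (coordChange g) ≤ RingHom.ker (parametrization S g r) := by
    rw [Ideal.map_le_iff_le_comap, binomialIdeal, varIdeal, ← Ideal.span_union, Ideal.span_le]
    rintro _ (⟨i, hi, rfl | rfl⟩ | ⟨i, j, -, hκ, rfl⟩)
    · change parametrization S g r (coordChange g (x L i)) = 0
      simp [coordChange_x, parametrization_x, parametrization_y, hi]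
    · change parametrization S g r (coordChange g (y L i)) = 0
      simp [coordChange_y, parametrization_x, parametrization_y, hi]
    · change parametrization S g r (coordChange g _) = 0
      have hC : ∀ a, parametrization S g r (C a) = C a := fun a => AlgHom.commutes _ a
      simp only [map_sub, map_mul, map_add, coordChange_x, coordChange_y, hC, parametrization_x,
        parametrization_y, hr i j hκ]
      split_ifs <;> ring
  exact this hf

end Generic

/-! ### Lowest terms and independence of the standard monomials. -/

lemma le_of_X_pow_dvd_of_coeff_ne_zero {σ R : Type*} [CommRing R] {s : σ} {a : ℕ}
    {p : MvPolynomial σ R} (h : X s ^ a ∣ p) {e : σ →₀ ℕ} (he : coeff e p ≠ 0) : a ≤ e s := by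
  classical
  obtain ⟨q, rfl⟩ := h
  rw [X_pow_eq_monomial, coeff_monomial_mul'] at he
  by_contra hlt
  exact he (if_neg fun hle => hlt (by simpa using hle s))

section Generic

variable {n : ℕ} {ι : Type*} {L : Type u} [Field L]
variable {S : Finset (Fin n)} {κ : Fin n → ι} {g : Fin n → GL (Fin 2) L} {r : Fin n → Fin n}

lemma parametrization_y_fixed {k : Fin n} (hk : r k = k) (hkS : k ∉ S) :
    parametrization S g r (y L k) = x L k * (C ((g k).1.det) * y L k) := by
  rw [parametrization_y, if_neg hkS, hk, Matrix.det_fin_two]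
  simp only [map_sub, map_mul]
  ring

lemma parametrization_x_fixed {k : Fin n} (hk : r k = k) (hkS : k ∉ S) :
    parametrization S g r (x L k) = x L k * C ((g k).1.det) := by
  rw [parametrization_x, if_neg hkS, hk, Matrix.det_fin_two]
  simp only [map_sub, map_mul]
  ring

lemma le_of_coeff_parametrization_ne_zero {m e : Fin n ⊕ Fin n →₀ ℕ} {c : L}
    (h : coeff e (parametrization S g r (monomial m c)) ≠ 0) :
    (∀ i, m (Sum.inl i) + m (Sum.inr i) ≤ e (Sum.inl i)) ∧
      ∀ k, r k = k → m (Sum.inr k) ≤ e (Sum.inr k) := by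
  classical
  constructor
  · intro i
    refine le_of_X_pow_dvd_of_coeff_ne_zero (dvd_trans ?_ (map_dvd (parametrization S g r)
      (a := x L i ^ m (Sum.inl i) * y L i ^ m (Sum.inr i)) ?_)) h
    · rw [map_mul, map_pow, map_pow, pow_add, parametrization_x, parametrization_y]
      refine mul_dvd_mul (pow_dvd_pow_of_dvd ?_ _) (pow_dvd_pow_of_dvd ?_ _)
      all_goals split_ifs
      exacts [dvd_zero _, dvd_mul_right _ _, dvd_zero _, dvd_mul_right _ _]
    · rw [x, y, X_pow_eq_monomial, X_pow_eq_monomial, monomial_mul, one_mul, monomial_dvd_monomial]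
      refine ⟨Or.inr fun s => ?_, one_dvd _⟩
      rw [Finsupp.add_apply, Finsupp.single_apply, Finsupp.single_apply]
      split_ifs with h₁ h₂ h₂
      · cases h₁.trans h₂.symm
      · subst h₁; simp
      · subst h₂; simp
      · simp
  · intro k hk
    refine le_of_X_pow_dvd_of_coeff_ne_zero (dvd_trans ?_ (map_dvd (parametrization S g r)
      (a := y L k ^ m (Sum.inr k)) ?_)) h
    · rw [map_pow]
      refine pow_dvd_pow_of_dvd ?_ _
      by_cases hkS : k ∈ S
      · rw [parametrization_y, if_pos hkS]
        exact dvd_zero _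
      · rw [parametrization_y_fixed hk hkS, ← mul_assoc]
        exact dvd_mul_left _ _
    · rw [y, X_pow_eq_monomial, monomial_dvd_monomial]
      refine ⟨Or.inr ?_, one_dvd _⟩
      simp

/-- The exponent of the lowest term of the image of the monomial `m` under `parametrization`. -/
def lowestExponent (r : Fin n → Fin n) (m : Fin n ⊕ Fin n →₀ ℕ) : Fin n ⊕ Fin n →₀ ℕ :=
  Finsupp.equivFunOnFinite.symm (Sum.elim (fun i => m (Sum.inl i) + m (Sum.inr i))
    (fun k => if r k = k then m (Sum.inr k) else 0))

lemma monomial_eq_prod_x_y {R : Type u} [Field R] (m : Fin n ⊕ Fin n →₀ ℕ) :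
    monomial m (1 : R) = ∏ i, x R i ^ m (Sum.inl i) * y R i ^ m (Sum.inr i) := by
  rw [monomial_eq, map_one, one_mul, Finsupp.prod_fintype _ _ (by simp), Fintype.prod_sum_type,
    Finset.prod_mul_distrib]
  rfl

/-- At a representative the image is a monomial times a power of `det g_i`. At any other vertex only
`y_i` may occur, and its image is `z_i` times a polynomial in `u` whose constant term is the minor
of the first rows of `g_i` and `g_(r i)`. -/
lemma coeff_lowestExponent_ne_zero (hg : ∀ i j, i ≠ j → rowMinor g i j ≠ 0)
    {m : Fin n ⊕ Fin n →₀ ℕ} (hS : ∀ i ∈ S, m (Sum.inl i) = 0 ∧ m (Sum.inr i) = 0)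
    (hm : ∀ i, m (Sum.inl i) ≠ 0 → r i = i) :
    coeff (lowestExponent r m) (parametrization S g r (monomial m 1)) ≠ 0 := by
  have hfac : ∀ i, ∃ q : PolyRing n L, constantCoeff q ≠ 0 ∧
      parametrization S g r (x L i ^ m (Sum.inl i) * y L i ^ m (Sum.inr i)) =
        x L i ^ lowestExponent r m (Sum.inl i) * y L i ^ lowestExponent r m (Sum.inr i) * q := by
    intro i
    have h₁ : lowestExponent r m (Sum.inl i) = m (Sum.inl i) + m (Sum.inr i) := rfl
    have h₂ : lowestExponent r m (Sum.inr i) = if r i = i then m (Sum.inr i) else 0 := rfl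
    rw [h₁, h₂]
    by_cases hi : i ∈ S
    · refine ⟨1, by simp, ?_⟩
      simp [hS i hi]
    by_cases hri : r i = i
    · refine ⟨C ((g i).1.det) ^ (m (Sum.inl i) + m (Sum.inr i)), ?_, ?_⟩
      · rw [map_pow, constantCoeff_C]
        exact pow_ne_zero _ ((Matrix.isUnit_iff_isUnit_det _).mp (g i).isUnit).ne_zero
      · rw [map_mul, map_pow, map_pow, parametrization_x_fixed hri hi,
          parametrization_y_fixed hri hi, if_pos hri]
        ring
    · have h0 : m (Sum.inl i) = 0 := by
        by_contra h
        exact hri (hm i h)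
      refine ⟨(C ((g i).1 0 0) * (C ((g (r i)).1 0 1) + C ((g (r i)).1 1 1) * y L (r i)) -
        C ((g i).1 0 1) * (C ((g (r i)).1 0 0) + C ((g (r i)).1 1 0) * y L (r i))) ^
          m (Sum.inr i), ?_, ?_⟩
      · rw [map_pow]
        refine pow_ne_zero _ ?_
        have := hg i (r i) (Ne.symm hri)
        simp only [map_sub, map_mul, map_add, constantCoeff_C, y, constantCoeff_X, mul_zero,
          add_zero]
        rwa [rowMinor, mul_comm ((g (r i)).1 0 0)] at this
      · rw [map_mul, map_pow, map_pow, parametrization_y, if_neg hi, if_neg hri, h0, mul_pow,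
          pow_zero, pow_zero, one_mul, mul_one, zero_add]
  choose q hq hfac using hfac
  rw [monomial_eq_prod_x_y, map_prod, Finset.prod_congr rfl fun i _ => hfac i,
    Finset.prod_mul_distrib, ← monomial_eq_prod_x_y]
  have := coeff_monomial_mul (R := L) 0 (lowestExponent r m) 1 (∏ i, q i)
  rw [add_zero, one_mul] at this
  rw [this, ← constantCoeff_eq, map_prod]
  exact Finset.prod_ne_zero_iff.mpr fun i _ => hq i

/-- The monomials outside `monomialIdeal`. -/
def IsStandard (S : Finset (Fin n)) (κ : Fin n → ι) (m : Fin n ⊕ Fin n →₀ ℕ) : Prop :=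
  (∀ i ∈ S, m (Sum.inl i) = 0 ∧ m (Sum.inr i) = 0) ∧
    ∀ i j, i ≠ j → κ i = κ j → m (Sum.inl i) = 0 ∨ m (Sum.inl j) = 0

lemma isStandard_iff {m : Fin n ⊕ Fin n →₀ ℕ} :
    IsStandard S κ m ↔ ∀ e ∈ monomialExponents S κ, ¬ e ≤ m := by
  constructor
  · rintro ⟨h₁, h₂⟩ e (⟨i, hi, rfl | rfl⟩ | ⟨i, j, hij, hκ, rfl⟩) hle
    · have := hle (Sum.inl i)
      simp [(h₁ i hi).1] at this
    · have := hle (Sum.inr i)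
      simp [(h₁ i hi).2] at this
    · have hi := hle (Sum.inl i)
      have hj := hle (Sum.inl j)
      simp only [Finsupp.add_apply, Finsupp.single_eq_same] at hi hj
      rcases h₂ i j hij hκ with h | h <;> omega
  · intro h
    refine ⟨fun i hi => ⟨?_, ?_⟩, fun i j hij hκ => ?_⟩
    · by_contra hne
      exact h _ (Or.inl ⟨i, hi, Or.inl rfl⟩) (by
        rw [Finsupp.single_le_iff]; omega)
    · by_contra hne
      exact h _ (Or.inl ⟨i, hi, Or.inr rfl⟩) (by
        rw [Finsupp.single_le_iff]; omega)
    · by_contra! hne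
      refine h _ (Or.inr ⟨i, j, hij, hκ, rfl⟩) fun s => ?_
      rw [Finsupp.add_apply, Finsupp.single_apply, Finsupp.single_apply]
      split_ifs with h₁ h₂ h₂
      · exact absurd (Sum.inl_injective (h₁.trans h₂.symm)) hij
      · subst h₁; omega
      · subst h₂; omega
      · omega

/-- In each class the representative is the unique vertex whose `x` occurs in `m`, if there is one,
and arbitrary otherwise. -/
lemma IsStandard.exists_representatives {m : Fin n ⊕ Fin n →₀ ℕ} (hm : IsStandard S κ m) :
    ∃ r : Fin n → Fin n, (∀ i j, κ i = κ j → r i = r j) ∧ ∀ i, m (Sum.inl i) ≠ 0 → r i = i := by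
  have h : ∀ l : Set.range κ, ∃ j, κ j = l ∧
      ∀ i, κ i = l → m (Sum.inl i) ≠ 0 → m (Sum.inl j) ≠ 0 := by
    rintro ⟨_, i₀, rfl⟩
    by_cases hex : ∃ j, κ j = κ i₀ ∧ m (Sum.inl j) ≠ 0
    · obtain ⟨j, hj, hmj⟩ := hex
      exact ⟨j, hj, fun _ _ _ => hmj⟩
    · exact ⟨i₀, rfl, fun i hi hmi => absurd ⟨i, hi, hmi⟩ hex⟩
  choose ρ hρκ hρ using h
  refine ⟨fun i => ρ ⟨κ i, i, rfl⟩, fun i j hij => ?_, fun i hi => ?_⟩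
  · simp only [hij]
  · by_contra hne
    have h₁ := hρ ⟨κ i, i, rfl⟩ i rfl hi
    rcases hm.2 _ i hne (hρκ ⟨κ i, i, rfl⟩) with h | h
    · exact h₁ h
    · exact hi h

/-- The standard monomials are linearly independent modulo the transformed ideal. -/
theorem eq_zero_of_forall_isStandard (hg : ∀ i j, i ≠ j → rowMinor g i j ≠ 0) {f : PolyRing n L}
    (hf : f ∈ (binomialIdeal L S κ).map (coordChange g))
    (hstd : ∀ m ∈ f.support, IsStandard S κ m) : f = 0 := by
  classical
  by_contra hne
  have hsupp : f.support.Nonempty := by rwa [Finset.nonempty_iff_ne_empty, Ne, support_eq_empty]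
  let deg : (Fin n ⊕ Fin n →₀ ℕ) → ℕ := fun m => ∑ i, (m (Sum.inl i) + m (Sum.inr i))
  let xdeg : (Fin n ⊕ Fin n →₀ ℕ) → ℕ := fun m => ∑ i, m (Sum.inl i)
  -- The selected monomial has least total degree and, among those, largest `x`-degree.
  obtain ⟨m₀, hm₀, hmin₀⟩ := Finset.exists_min_image f.support deg hsupp
  obtain ⟨m, hm, hmax⟩ := Finset.exists_max_image (f.support.filter fun m => deg m = deg m₀) xdeg
    ⟨m₀, by simpa using hm₀⟩
  rw [Finset.mem_filter] at hm
  obtain ⟨hm, hdeg⟩ := hm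
  have hmin : ∀ m' ∈ f.support, deg m ≤ deg m' := fun m' hm' => hdeg ▸ hmin₀ m' hm'
  obtain ⟨r, hrκ, hr⟩ := (hstd m hm).exists_representatives
  have hz := parametrization_eq_zero (r := r) hrκ hf
  -- If `m'` also contributed, divisibility by the `z_i` and minimality of the degree would give
  -- equal degrees at every vertex. Divisibility by `u_i` at vertices where `x_i` occurs in `m` then
  -- makes the `x`-exponents of `m'` at least those of `m`, and maximality gives `m' = m`.
  have hzero : ∀ m' ∈ f.support, m' ≠ m →
      coeff (lowestExponent r m) (parametrization S g r (monomial m' (coeff m' f))) = 0 := by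
    intro m' hm' hmm'
    by_contra hcoeff
    obtain ⟨h₁, h₂⟩ := le_of_coeff_parametrization_ne_zero hcoeff
    have h₁' : ∀ i, m' (Sum.inl i) + m' (Sum.inr i) ≤ m (Sum.inl i) + m (Sum.inr i) := h₁
    have heq : ∀ i, m' (Sum.inl i) + m' (Sum.inr i) = m (Sum.inl i) + m (Sum.inr i) := by
      have := (Finset.sum_eq_sum_iff_of_le fun i (_ : i ∈ Finset.univ) => h₁' i).mp
        (le_antisymm (Finset.sum_le_sum fun i _ => h₁' i) (hmin m' hm'))
      exact fun i => this i (Finset.mem_univ i)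
    have hdeg' : deg m' = deg m₀ := by
      rw [← hdeg]
      exact Finset.sum_congr rfl fun i _ => heq i
    have hx : ∀ i, m (Sum.inl i) ≤ m' (Sum.inl i) := by
      intro i
      by_cases hi : m (Sum.inl i) = 0
      · omega
      · have h : m' (Sum.inr i) ≤ if r i = i then m (Sum.inr i) else 0 := h₂ i (hr i hi)
        rw [if_pos (hr i hi)] at h
        have := heq i
        omega
    have hxeq : ∀ i, m (Sum.inl i) = m' (Sum.inl i) := by
      have := (Finset.sum_eq_sum_iff_of_le fun i (_ : i ∈ Finset.univ) => hx i).mp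
        (le_antisymm (Finset.sum_le_sum fun i _ => hx i)
          (hmax m' (Finset.mem_filter.mpr ⟨hm', hdeg'⟩)))
      exact fun i => this i (Finset.mem_univ i)
    refine hmm' (Finsupp.ext ?_)
    rintro (i | i)
    · exact (hxeq i).symm
    · have := heq i
      have := hxeq i
      omega
  rw [f.as_sum, map_sum] at hz
  have hz' := congrArg (coeff (lowestExponent r m)) hz
  rw [coeff_sum, Finset.sum_eq_single m hzero (fun h => absurd hm h), coeff_zero,
    ← mul_one (coeff m f), ← smul_eq_mul, ← smul_monomial, map_smul, coeff_smul, smul_eq_mul] at hz'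
  rcases mul_eq_zero.mp hz' with h | h
  · exact (mem_support_iff.mp hm) h
  · exact coeff_lowestExponent_ne_zero hg (hstd m hm).1 hr h

end Generic

/-! ### Descent of ideal membership along a field extension. -/

section ScalarExtension

variable {σ K L : Type*} [Field K] [Field L] [Algebra K L]

/-- Application of a `K`-linear map `L → K` to the coefficients of a polynomial. -/
def mapCoeff (π : L →ₗ[K] K) (q : MvPolynomial σ L) : MvPolynomial σ K :=
  ∑ e ∈ q.support, monomial e (π (coeff e q))

lemma coeff_mapCoeff (π : L →ₗ[K] K) (q : MvPolynomial σ L) (e : σ →₀ ℕ) :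
    coeff e (mapCoeff π q) = π (coeff e q) := by
  classical
  rw [mapCoeff, coeff_sum]
  simp only [coeff_monomial, Finset.sum_ite_eq']
  split_ifs with h
  · rfl
  · rw [notMem_support_iff.mp h, map_zero]

lemma mapCoeff_mul_map (π : L →ₗ[K] K) (q : MvPolynomial σ L) (p : MvPolynomial σ K) :
    mapCoeff π (q * map (algebraMap K L) p) = mapCoeff π q * p := by
  classical
  ext e
  rw [coeff_mapCoeff, coeff_mul, coeff_mul, map_sum]
  refine Finset.sum_congr rfl fun ab _ => ?_
  rw [coeff_map, coeff_mapCoeff, mul_comm, ← Algebra.smul_def, map_smul, smul_eq_mul, mul_comm]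

lemma mapCoeff_mul_mem (π : L →ₗ[K] K) {I : Ideal (MvPolynomial σ K)} {q : MvPolynomial σ L}
    (hq : q ∈ I.map (map (algebraMap K L))) (a : MvPolynomial σ L) : mapCoeff π (a * q) ∈ I := by
  induction hq using Submodule.span_induction generalizing a with
  | mem q hq =>
    obtain ⟨p, hp, rfl⟩ := hq
    rw [mapCoeff_mul_map]
    exact I.mul_mem_left _ hp
  | zero =>
    rw [mul_zero]
    simp [mapCoeff]
  | add q q' _ _ hq hq' =>
    have : mapCoeff π (a * (q + q')) = mapCoeff π (a * q) + mapCoeff π (a * q') := by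
      ext e
      simp only [coeff_mapCoeff, coeff_add, mul_add, map_add]
    rw [this]
    exact I.add_mem (hq a) (hq' a)
  | smul b q _ hq =>
    rw [smul_eq_mul, ← mul_assoc]
    exact hq _

/-- A `K`-linear retraction of `K → L`, applied to coefficients, is linear over the polynomial ring
of `K`; it carries the extended ideal back into `I` and fixes `p`. -/
lemma map_mem_map_iff {I : Ideal (MvPolynomial σ K)} {p : MvPolynomial σ K} :
    map (algebraMap K L) p ∈ I.map (map (algebraMap K L)) ↔ p ∈ I := by
  refine ⟨fun h => ?_, fun h => Ideal.mem_map_of_mem _ h⟩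
  obtain ⟨π, hπ⟩ := (Algebra.linearMap K L).exists_leftInverse_of_injective
    (LinearMap.ker_eq_bot.mpr (algebraMap K L).injective)
  have hπ1 : π 1 = 1 := by simpa using LinearMap.congr_fun hπ 1
  have h1 := mapCoeff_mul_mem π h 1
  rw [mapCoeff_mul_map] at h1
  have : mapCoeff π (1 : MvPolynomial σ L) = 1 := by
    classical
    ext e
    rw [coeff_mapCoeff, coeff_one, coeff_one]
    split_ifs <;> simp [hπ1]
  rwa [this, one_mul] at h1

end ScalarExtension

lemma extendScalars_injective {n : ℕ} {K : Type u} [Field K] (L : Type u) [Field L] [Algebra K L] :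
    Function.Injective (extendScalars (n := n) (K := K) L) := by
  intro I J h
  ext p
  rw [← map_mem_map_iff (L := L) (I := I), ← map_mem_map_iff (L := L) (I := J)]
  unfold extendScalars at h
  rw [h]

/-! ### Nonempty Zariski open sets of coordinate changes. -/

section ZariskiOpen

variable {n : ℕ} {L : Type u} [Field L]

/-- The product of the two defining polynomials and all the determinants is a nonzero polynomial, so
over an infinite field it is nonzero at some point; the determinant factor makes that point a tuple
of invertible matrices. -/
lemma IsZariskiOpen.inter_nonempty [Infinite L] {U V : Set (Fin n → GL (Fin 2) L)}
    (hU : IsZariskiOpen U) (hV : IsZariskiOpen V) (hU' : U.Nonempty) (hV' : V.Nonempty) :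
    (U ∩ V).Nonempty := by
  obtain ⟨F, rfl⟩ := hU
  obtain ⟨F', rfl⟩ := hV
  obtain ⟨g, f, hf, hfg⟩ := hU'
  obtain ⟨g', f', hf', hfg'⟩ := hV'
  let D : MvPolynomial (Fin n × Fin 2 × Fin 2) L :=
    ∏ i, (X (i, 0, 0) * X (i, 1, 1) - X (i, 0, 1) * X (i, 1, 0))
  have hne : ∀ {q : MvPolynomial (Fin n × Fin 2 × Fin 2) L} {p : Fin n × Fin 2 × Fin 2 → L},
      eval p q ≠ 0 → q ≠ 0 := by
    rintro q p hp rfl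
    exact hp (map_zero _)
  have hD : D ≠ 0 := by
    refine hne (p := fun e => (g e.1).1 e.2.1 e.2.2) ?_
    rw [map_prod]
    refine Finset.prod_ne_zero_iff.mpr fun i _ => ?_
    have := ((Matrix.isUnit_iff_isUnit_det _).mp (g i).isUnit).ne_zero
    rw [Matrix.det_fin_two] at this
    simpa using this
  have hprod : f * f' * D ≠ 0 := mul_ne_zero (mul_ne_zero (hne hfg) (hne hfg')) hD
  obtain ⟨p, hp⟩ : ∃ p, eval p (f * f' * D) ≠ 0 := by
    by_contra! h
    exact hprod (MvPolynomial.funext fun p => by rw [h p, map_zero])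
  rw [map_mul, map_mul] at hp
  have hpD : eval p D ≠ 0 := right_ne_zero_of_mul hp
  rw [map_prod] at hpD
  have hdet : ∀ i, (Matrix.of fun a b => p (i, a, b)).det ≠ 0 := by
    intro i
    rw [Matrix.det_fin_two]
    simpa using Finset.prod_ne_zero_iff.mp hpD i (Finset.mem_univ i)
  refine ⟨fun i => Matrix.GeneralLinearGroup.mkOfDetNeZero _ (hdet i), ⟨f, hf, ?_⟩, ⟨f', hf', ?_⟩⟩
  · exact left_ne_zero_of_mul (left_ne_zero_of_mul hp)
  · exact right_ne_zero_of_mul (left_ne_zero_of_mul hp)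

lemma isZariskiOpen_rowMinor :
    IsZariskiOpen {g : Fin n → GL (Fin 2) L | ∀ i j, i ≠ j → rowMinor g i j ≠ 0} := by
  refine ⟨{∏ e ∈ (Finset.univ : Finset (Fin n)).offDiag,
    (X (e.1, 0, 0) * X (e.2, 0, 1) - X (e.2, 0, 0) * X (e.1, 0, 1))}, ?_⟩
  ext g
  simp only [Set.mem_ofPred_eq, Set.mem_singleton_iff, exists_eq_left, map_prod,
    Finset.prod_ne_zero_iff, Finset.mem_offDiag, Finset.mem_univ, true_and, Prod.forall, map_sub,
    map_mul, eval_X]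
  rfl

lemma nonempty_rowMinor [Infinite L] :
    {g : Fin n → GL (Fin 2) L | ∀ i j, i ≠ j → rowMinor g i j ≠ 0}.Nonempty := by
  let b : Fin n → L := fun i => Infinite.natEmbedding L i
  -- For these unipotent matrices the minor of the first rows is `b j - b i`.
  refine ⟨fun i => Matrix.GeneralLinearGroup.mkOfDetNeZero !![1, b i; 0, 1] (by simp), ?_⟩
  intro i j hij
  have hb : b j ≠ b i := fun h => hij (Fin.ext ((Infinite.natEmbedding L).injective h).symm)
  simpa [rowMinor, Matrix.GeneralLinearGroup.mkOfDetNeZero, sub_eq_zero] using hb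

end ZariskiOpen

/-! ### Uniqueness and computation of the generic initial ideal. -/

section Gin

variable {n : ℕ} {K : Type u} [Field K] {τ : MonomialOrder.{0, v} (Fin n ⊕ Fin n)}

theorem IsGin.unique {I M M' : Ideal (PolyRing n K)} (h : IsGin τ I M) (h' : IsGin τ I M') :
    M = M' := by
  -- The algebraic closure is infinite even when `K` is finite.
  obtain ⟨U, hUo, hU, hUeq⟩ := h (AlgebraicClosure K)
  obtain ⟨V, hVo, hV, hVeq⟩ := h' (AlgebraicClosure K)
  obtain ⟨g, hgU, hgV⟩ := hUo.inter_nonempty hVo hU hV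
  exact extendScalars_injective _ ((hUeq g hgU).symm.trans (hVeq g hgV))

theorem IsGin.gin_eq {I M : Ideal (PolyRing n K)} (h : IsGin τ I M) : gin τ I = M := by
  have hex : ∃ M, IsGin τ I M := ⟨M, h⟩
  rw [gin, dif_pos hex]
  exact hex.choose_spec.unique h

variable {ι : Type*} {L : Type u} [Field L] {S : Finset (Fin n)} {κ : Fin n → ι}

lemma mem_map_coordChange_of_mem (g : Fin n → GL (Fin 2) L) {i : Fin n} (hi : i ∈ S) :
    x L i ∈ (binomialIdeal L S κ).map (coordChange g) ∧
      y L i ∈ (binomialIdeal L S κ).map (coordChange g) := by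
  have hx : coordChange g (x L i) ∈ (binomialIdeal L S κ).map (coordChange g) :=
    Ideal.mem_map_of_mem _ (Ideal.mem_sup_left (Ideal.subset_span ⟨i, hi, Or.inl rfl⟩))
  have hy : coordChange g (y L i) ∈ (binomialIdeal L S κ).map (coordChange g) :=
    Ideal.mem_map_of_mem _ (Ideal.mem_sup_left (Ideal.subset_span ⟨i, hi, Or.inr rfl⟩))
  rw [coordChange_x] at hx
  rw [coordChange_y] at hy
  have hdet := ((Matrix.isUnit_iff_isUnit_det _).mp (g i).isUnit).ne_zero
  rw [Matrix.det_fin_two] at hdet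
  set a := (g i).1 0 0
  set b := (g i).1 0 1
  set c := (g i).1 1 0
  set d := (g i).1 1 1
  have hunit : (C (a * d - b * c)⁻¹ * (C a * C d - C b * C c) : PolyRing n L) = 1 := by
    rw [← C_mul, ← C_mul, ← C_sub, ← C_mul, inv_mul_cancel₀ hdet, C_1]
  constructor
  · have : x L i = C (a * d - b * c)⁻¹ *
        (C d * (C a * x L i + C c * y L i) - C c * (C b * x L i + C d * y L i)) := by
      linear_combination -(x L i) * hunit
    rw [this]
    exact Ideal.mul_mem_left _ _ (sub_mem (Ideal.mul_mem_left _ _ hx) (Ideal.mul_mem_left _ _ hy))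
  · have : y L i = C (a * d - b * c)⁻¹ *
        (C a * (C b * x L i + C d * y L i) - C b * (C a * x L i + C c * y L i)) := by
      linear_combination -(y L i) * hunit
    rw [this]
    exact Ideal.mul_mem_left _ _ (sub_mem (Ideal.mul_mem_left _ _ hy) (Ideal.mul_mem_left _ _ hx))

lemma exists_degree_eq
    (hτ : ∀ i : Fin n, τ.toSyn (Finsupp.single (Sum.inr i) 1) <
      τ.toSyn (Finsupp.single (Sum.inl i) 1))
    {g : Fin n → GL (Fin 2) L} (hg : ∀ i j, i ≠ j → rowMinor g i j ≠ 0)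
    {e : Fin n ⊕ Fin n →₀ ℕ} (he : e ∈ monomialExponents S κ) :
    ∃ b ∈ (binomialIdeal L S κ).map (coordChange g), b ≠ 0 ∧ τ.degree b = e := by
  rcases he with ⟨i, hi, rfl | rfl⟩ | ⟨i, j, hij, hκ, rfl⟩
  · exact ⟨_, (mem_map_coordChange_of_mem g hi).1, X_ne_zero _, τ.degree_X⟩
  · exact ⟨_, (mem_map_coordChange_of_mem g hi).2, X_ne_zero _, τ.degree_X⟩
  · have hdeg := degree_coordChange_minor τ hτ (hg i j hij)
    refine ⟨_, Ideal.mem_map_of_mem _ (Ideal.mem_sup_right (Ideal.subset_span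
      ⟨i, j, hij, hκ, rfl⟩)), ?_, hdeg⟩
    refine τ.ne_zero_of_degree_ne_zero ?_
    rw [hdeg]
    intro h
    simpa using DFunLike.congr_fun h (Sum.inl i)

theorem initialIdeal_map_coordChange
    (hτ : ∀ i : Fin n, τ.toSyn (Finsupp.single (Sum.inr i) 1) <
      τ.toSyn (Finsupp.single (Sum.inl i) 1))
    {g : Fin n → GL (Fin 2) L} (hg : ∀ i j, i ≠ j → rowMinor g i j ≠ 0) :
    initialIdeal τ ((binomialIdeal L S κ).map (coordChange g)) = monomialIdeal L S κ := by
  rw [monomialIdeal_eq_span]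
  apply le_antisymm
  · rw [initialIdeal, Ideal.span_le]
    rintro _ ⟨f, hf, rfl⟩
    rcases eq_or_ne f 0 with rfl | hf0
    · rw [τ.leadingTerm_zero]
      exact Ideal.zero_mem _
    suffices h : ∃ e ∈ monomialExponents S κ, e ≤ τ.degree f by
      refine mem_ideal_span_monomial_image.mpr fun m hm => ?_
      rw [τ.support_leadingTerm' hf0, Finset.mem_singleton] at hm
      exact hm ▸ h
    choose b hbmem hb0 hbdeg using fun e : monomialExponents S κ =>
      exists_degree_eq (S := S) (κ := κ) hτ hg e.2
    -- Division by elements whose leading monomials are the generators leaves a remainder supported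
    -- on standard monomials, hence zero. The leading monomial of `f` then comes from some product
    -- `b e * q e`, whose degree does not exceed that of `f`, so `e` divides it.
    obtain ⟨q, r, hfqr, hdeg, hr⟩ := τ.div
      (fun e => τ.isUnit_leadingCoeff.mpr (hb0 e)) f
    have hlc : Finsupp.linearCombination (PolyRing n L) b q ∈
        (binomialIdeal L S κ).map (coordChange g) := by
      rw [Finsupp.linearCombination_apply]
      exact Ideal.sum_mem _ fun e _ => Ideal.mul_mem_left _ _ (hbmem e)
    have hrmem : r ∈ (binomialIdeal L S κ).map (coordChange g) := by
      have : r = f - Finsupp.linearCombination (PolyRing n L) b q := by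
        rw [hfqr, add_sub_cancel_left]
      rw [this]
      exact sub_mem hf hlc
    have hr0 : r = 0 := eq_zero_of_forall_isStandard hg hrmem fun m hm =>
      isStandard_iff.mpr fun e he hle => hr m hm ⟨e, he⟩ ((hbdeg ⟨e, he⟩).trans_le hle)
    rw [hr0, add_zero] at hfqr
    have hcoeff : coeff (τ.degree f) f ≠ 0 := τ.coeff_degree_ne_zero_iff.mpr hf0
    nth_rewrite 2 [hfqr] at hcoeff
    rw [Finsupp.linearCombination_apply, Finsupp.sum, coeff_sum] at hcoeff
    obtain ⟨e, -, he⟩ := Finset.exists_ne_zero_of_sum_ne_zero hcoeff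
    rw [smul_eq_mul, mul_comm] at he
    have hne : b e * q e ≠ 0 := by
      intro h
      rw [h, coeff_zero] at he
      exact he rfl
    have heq : τ.degree f = τ.degree (b e * q e) :=
      τ.toSyn.injective (le_antisymm (τ.le_degree (mem_support_iff.mpr he)) (hdeg e))
    refine ⟨e, e.2, ?_⟩
    rw [heq, τ.degree_mul' hne, hbdeg]
    exact le_self_add
  · rw [Ideal.span_le]
    rintro _ ⟨e, he, rfl⟩
    obtain ⟨b, hb, hb0, rfl⟩ := exists_degree_eq (S := S) (κ := κ) hτ hg he
    have hlt : τ.leadingTerm b ∈ initialIdeal τ ((binomialIdeal L S κ).map (coordChange g)) :=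
      Ideal.subset_span ⟨b, hb, rfl⟩
    have := Ideal.mul_mem_left _ (C (τ.leadingCoeff b)⁻¹) hlt
    rwa [MonomialOrder.leadingTerm, C_mul_monomial,
      inv_mul_cancel₀ (τ.leadingCoeff_ne_zero_iff.mpr hb0)] at this

lemma extendScalars_varIdeal [Algebra K L] : extendScalars L (varIdeal K S) = varIdeal L S := by
  rw [extendScalars, varIdeal, varIdeal, Ideal.map_span]
  congr 1
  ext f
  constructor
  · rintro ⟨_, ⟨i, hi, rfl | rfl⟩, rfl⟩
    · exact ⟨i, hi, Or.inl (map_X _ _)⟩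
    · exact ⟨i, hi, Or.inr (map_X _ _)⟩
  · rintro ⟨i, hi, rfl | rfl⟩
    · exact ⟨_, ⟨i, hi, Or.inl rfl⟩, map_X _ _⟩
    · exact ⟨_, ⟨i, hi, Or.inr rfl⟩, map_X _ _⟩

lemma extendScalars_binomialIdeal [Algebra K L] :
    extendScalars L (binomialIdeal K S κ) = binomialIdeal L S κ := by
  rw [binomialIdeal, extendScalars, Ideal.map_sup, ← extendScalars, extendScalars_varIdeal,
    binomialIdeal, Ideal.map_span]
  congr 2
  ext f
  constructor
  · rintro ⟨_, ⟨i, j, hij, hκ, rfl⟩, rfl⟩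
    exact ⟨i, j, hij, hκ, by simp [x, y]⟩
  · rintro ⟨i, j, hij, hκ, rfl⟩
    exact ⟨_, ⟨i, j, hij, hκ, rfl⟩, by simp [x, y]⟩

lemma extendScalars_monomialIdeal [Algebra K L] :
    extendScalars L (monomialIdeal K S κ) = monomialIdeal L S κ := by
  rw [monomialIdeal, extendScalars, Ideal.map_sup, ← extendScalars, extendScalars_varIdeal,
    monomialIdeal, Ideal.map_span]
  congr 2
  ext f
  constructor
  · rintro ⟨_, ⟨i, j, hij, hκ, rfl⟩, rfl⟩
    exact ⟨i, j, hij, hκ, by simp [x]⟩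
  · rintro ⟨i, j, hij, hκ, rfl⟩
    exact ⟨_, ⟨i, j, hij, hκ, rfl⟩, by simp [x]⟩

theorem isGin_binomialIdeal
    (hτ : ∀ i : Fin n, τ.toSyn (Finsupp.single (Sum.inr i) 1) <
      τ.toSyn (Finsupp.single (Sum.inl i) 1)) (S : Finset (Fin n)) (κ : Fin n → ι) :
    IsGin τ (binomialIdeal K S κ) (monomialIdeal K S κ) := by
  intro L _ _ _
  refine ⟨_, isZariskiOpen_rowMinor, nonempty_rowMinor, fun g hg => ?_⟩
  rw [extendScalars_binomialIdeal, extendScalars_monomialIdeal]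
  exact initialIdeal_map_coordChange hτ hg

end Gin

/-! ### Height of the monomial ideal through transversals. -/

section Height

variable {n : ℕ} {ι : Type*} {K : Type u} [Field K] {S : Finset (Fin n)} {κ : Fin n → ι}

/-- The variables generating the prime over `monomialIdeal` given by a set `R` of representatives:
the `x_i` with `i ∉ R` and the `y_i` with `i ∈ S`. -/
def primeVars (S R : Finset (Fin n)) : Finset (Fin n ⊕ Fin n) := Rᶜ.disjSum S

lemma monomialIdeal_le_span_primeVars {R : Finset (Fin n)}
    (hRS : (R : Set (Fin n)) ⊆ (S : Set (Fin n))ᶜ) (hinj : Set.InjOn κ R) :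
    monomialIdeal K S κ ≤ Ideal.span (X '' (primeVars S R : Set (Fin n ⊕ Fin n))) := by
  rw [monomialIdeal, varIdeal, ← Ideal.span_union, Ideal.span_le]
  rintro _ (⟨i, hi, rfl | rfl⟩ | ⟨i, j, hij, hκ, rfl⟩)
  · refine X_mem_span_X_image.mpr ?_
    simpa [primeVars] using fun h => hRS h hi
  · refine X_mem_span_X_image.mpr ?_
    simpa [primeVars] using hi
  · by_cases hi : i ∈ R
    · have hj : j ∉ R := fun hj => hij (hinj hi hj hκ)
      exact Ideal.mul_mem_left _ _ (X_mem_span_X_image.mpr (by simpa [primeVars] using hj))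
    · exact Ideal.mul_mem_right _ _ (X_mem_span_X_image.mpr (by simpa [primeVars] using hi))

lemma exists_span_primeVars_le {P : Ideal (PolyRing n K)} [hP : P.IsPrime]
    (hle : monomialIdeal K S κ ≤ P) :
    ∃ R : Finset (Fin n), Set.BijOn κ R (κ '' (S : Set (Fin n))ᶜ) ∧
      Ideal.span (X '' (primeVars S R : Set (Fin n ⊕ Fin n))) ≤ P := by
  have hvar : ∀ i ∈ S, x K i ∈ P ∧ y K i ∈ P := fun i hi =>
    ⟨hle (Ideal.mem_sup_left (Ideal.subset_span ⟨i, hi, Or.inl rfl⟩)),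
      hle (Ideal.mem_sup_left (Ideal.subset_span ⟨i, hi, Or.inr rfl⟩))⟩
  have hinj : Set.InjOn κ {i | x K i ∉ P} := by
    intro i hi j hj hκ
    by_contra hij
    have : x K i * x K j ∈ P :=
      hle (Ideal.mem_sup_right (Ideal.subset_span ⟨i, j, hij, hκ, rfl⟩))
    rcases hP.mem_or_mem this with h | h
    · exact hi h
    · exact hj h
  have hsub : {i | x K i ∉ P} ⊆ (S : Set (Fin n))ᶜ := fun i hi hiS => hi (hvar i hiS).1
  -- At most one `x_i` per class lies outside `P`; these indices extend to a full transversal `R`,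
  -- so every `x_i` with `i ∉ R` lies in `P`.
  obtain ⟨R, hNR, -, hbij⟩ := hinj.bijOn_image.exists_extend_of_subset hsub
    (Set.image_mono hsub) (Set.surjOn_image κ _)
  refine ⟨(Set.toFinite R).toFinset, by simpa using hbij, ?_⟩
  rw [Ideal.span_le]
  rintro _ ⟨i | i, hi, rfl⟩
  · have hi' : i ∉ R := by simpa [primeVars] using hi
    by_contra h
    exact hi' (hNR h)
  · exact (hvar i (by simpa [primeVars] using hi)).2

lemma height_span_primeVars {R : Finset (Fin n)}
    (hR : Set.BijOn κ R (κ '' (S : Set (Fin n))ᶜ)) :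
    (Ideal.span (X '' (primeVars S R : Set (Fin n ⊕ Fin n)) : Set (PolyRing n K))).height =
      ((n - (κ '' (S : Set (Fin n))ᶜ).ncard + S.card : ℕ) : ℕ∞) := by
  rw [height_span_X_image, primeVars, Finset.card_disjSum, Finset.card_compl, Fintype.card_fin,
    ← hR.image_eq, hR.injOn.ncard_image, Set.ncard_coe_finset]

/-- All the primes attached to transversals have the same height. One of them contains the ideal,
which bounds the height above; each minimal prime contains one of them, which bounds it below. -/
theorem height_monomialIdeal :
    (monomialIdeal K S κ).height + ((κ '' (S : Set (Fin n))ᶜ).ncard : ℕ∞) =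
      (n : ℕ∞) + (S.card : ℕ∞) := by
  have hheight : (monomialIdeal K S κ).height =
      ((n - (κ '' (S : Set (Fin n))ᶜ).ncard + S.card : ℕ) : ℕ∞) := by
    apply le_antisymm
    · obtain ⟨R, hRS, hR⟩ := Set.exists_subset_bijOn (S : Set (Fin n))ᶜ κ
      rw [← (Set.toFinite R).coe_toFinset] at hRS hR
      rw [← height_span_primeVars (K := K) hR]
      exact Ideal.height_mono (monomialIdeal_le_span_primeVars hRS hR.injOn)
    · rw [Ideal.height_eq_inf_minimalPrimes]
      refine le_iInf₂ fun J hJ => ?_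
      have := hJ.1.1
      obtain ⟨R, hR, hRJ⟩ := exists_span_primeVars_le hJ.1.2
      rw [← height_span_primeVars (K := K) hR]
      exact Ideal.height_mono hRJ
  have hle : (κ '' (S : Set (Fin n))ᶜ).ncard ≤ n := by
    refine (Set.ncard_image_le (Set.toFinite _)).trans ?_
    simpa using Set.ncard_le_card (S : Set (Fin n))ᶜ
  rw [hheight, ← Nat.cast_add, ← Nat.cast_add, add_right_comm, Nat.sub_add_cancel hle]

end Height

/-! ### Connected components as labels. -/

section Components

variable {n : ℕ} {K : Type u} [Field K]

open Classical in
/-- The labelling of the vertices of `G \ S` by the connected components. -/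
def componentLabel (G : SimpleGraph (Fin n)) (S : Finset (Fin n)) (i : Fin n) :
    Option (Component G S) :=
  if h : i ∈ S then none
  else some ((G.induce ((S : Set (Fin n))ᶜ)).connectedComponentMk ⟨i, by simpa using h⟩)

lemma mem_componentVerts_iff {G : SimpleGraph (Fin n)} {S : Finset (Fin n)} {i : Fin n}
    {C : Component G S} : i ∈ componentVerts C ↔ componentLabel G S i = some C := by
  constructor
  · rintro ⟨⟨j, hj⟩, hC, rfl⟩
    rw [componentLabel, dif_neg (by simpa using hj)]
    exact congrArg some hC
  · intro h
    by_cases hi : i ∈ S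
    · rw [componentLabel, dif_pos hi] at h
      cases h
    · rw [componentLabel, dif_neg hi] at h
      exact ⟨⟨i, by simpa using hi⟩, Option.some_injective _ h, rfl⟩

lemma componentLabel_eq_none_iff {G : SimpleGraph (Fin n)} {S : Finset (Fin n)} {i : Fin n} :
    componentLabel G S i = none ↔ i ∈ S := by
  rw [componentLabel]
  split_ifs with h <;> simp [h]

/-- The vertices of `S` share the label `none`, which adds minors between them; these already lie in
the ideal of the variables indexed by `S`. -/
lemma primeP_eq_binomialIdeal (G : SimpleGraph (Fin n)) (S : Finset (Fin n)) :
    primeP K G S = binomialIdeal K S (componentLabel G S) := by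
  apply le_antisymm
  · refine sup_le le_sup_left (iSup_le fun C => ?_)
    rw [edgeIdeal, Ideal.span_le]
    rintro _ ⟨i, j, ⟨hij, hi, hj⟩, rfl⟩
    refine Ideal.mem_sup_right (Ideal.subset_span ⟨i, j, hij, ?_, rfl⟩)
    rw [mem_componentVerts_iff.mp hi, mem_componentVerts_iff.mp hj]
  · refine sup_le le_sup_left (Ideal.span_le.mpr ?_)
    rintro _ ⟨i, j, hij, hκ, rfl⟩
    rcases h : componentLabel G S i with _ | C
    · have hi := componentLabel_eq_none_iff.mp h
      have hj := componentLabel_eq_none_iff.mp (hκ ▸ h)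
      refine Ideal.mem_sup_left (sub_mem (Ideal.mul_mem_right _ _ ?_) (Ideal.mul_mem_right _ _ ?_))
      · exact Ideal.subset_span ⟨i, hi, Or.inl rfl⟩
      · exact Ideal.subset_span ⟨j, hj, Or.inl rfl⟩
    · refine Ideal.mem_sup_right (Ideal.mem_iSup_of_mem C (Ideal.subset_span ⟨i, j, ⟨hij, ?_, ?_⟩,
        rfl⟩))
      · exact mem_componentVerts_iff.mpr h
      · exact mem_componentVerts_iff.mpr (hκ ▸ h)

lemma monomialIdeal_componentLabel (G : SimpleGraph (Fin n)) (S : Finset (Fin n)) :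
    monomialIdeal K S (componentLabel G S) =
      varIdeal K S ⊔ ⨆ C : Component G S, axesIdeal K (Sum.inl '' componentVerts C) := by
  apply le_antisymm
  · refine sup_le le_sup_left (Ideal.span_le.mpr ?_)
    rintro _ ⟨i, j, hij, hκ, rfl⟩
    rcases h : componentLabel G S i with _ | C
    · have hi := componentLabel_eq_none_iff.mp h
      exact Ideal.mem_sup_left (Ideal.mul_mem_right _ _ (Ideal.subset_span ⟨i, hi, Or.inl rfl⟩))
    · refine Ideal.mem_sup_right (Ideal.mem_iSup_of_mem C (Ideal.subset_span
        ⟨_, ⟨i, mem_componentVerts_iff.mpr h, rfl⟩, _,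
          ⟨j, mem_componentVerts_iff.mpr (hκ ▸ h), rfl⟩, fun h => hij (Sum.inl_injective h), rfl⟩))
  · refine sup_le le_sup_left (iSup_le fun C => ?_)
    rw [axesIdeal, Ideal.span_le]
    rintro _ ⟨_, ⟨i, hi, rfl⟩, _, ⟨j, hj, rfl⟩, hij, rfl⟩
    refine Ideal.mem_sup_right (Ideal.subset_span ⟨i, j, fun h => hij (congrArg _ h), ?_, rfl⟩)
    rw [mem_componentVerts_iff.mp hi, mem_componentVerts_iff.mp hj]

lemma ncard_image_componentLabel (G : SimpleGraph (Fin n)) (S : Finset (Fin n)) :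
    (componentLabel G S '' (S : Set (Fin n))ᶜ).ncard = Nat.card (Component G S) := by
  have : componentLabel G S '' (S : Set (Fin n))ᶜ = some '' Set.univ := by
    ext c
    constructor
    · rintro ⟨i, hi, rfl⟩
      rcases h : componentLabel G S i with _ | C
      · exact absurd (componentLabel_eq_none_iff.mp h) hi
      · exact ⟨C, trivial, rfl⟩
    · rintro ⟨C, -, rfl⟩
      obtain ⟨⟨i, hi⟩, hC⟩ := C.nonempty_supp
      exact ⟨i, hi, mem_componentVerts_iff.mp ⟨⟨i, hi⟩, hC, rfl⟩⟩
  rw [this, Set.ncard_image_of_injective _ (Option.some_injective _), Set.ncard_univ]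

end Components

/-! ### A single complete graph. -/

section Cliques

variable {n : ℕ} {K : Type u} [Field K]

open Classical in
/-- The labelling for which the only two vertices with the same label are those in `W`. -/
def cliqueLabel (W : Set (Fin n)) (i : Fin n) : Option (Fin n) := if i ∈ W then none else some i

lemma cliqueLabel_eq_iff {W : Set (Fin n)} {i j : Fin n} (hij : i ≠ j) :
    cliqueLabel W i = cliqueLabel W j ↔ i ∈ W ∧ j ∈ W := by
  by_cases hi : i ∈ W <;> by_cases hj : j ∈ W <;> simp [cliqueLabel, hi, hj, hij]

lemma varIdeal_empty : varIdeal K (∅ : Finset (Fin n)) = ⊥ := by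
  simp [varIdeal]

lemma edgeIdeal_completeOn (W : Set (Fin n)) :
    edgeIdeal K (completeOn W) = binomialIdeal K ∅ (cliqueLabel W) := by
  rw [binomialIdeal, varIdeal_empty, bot_sup_eq, edgeIdeal]
  congr 1
  ext f
  constructor
  · rintro ⟨i, j, ⟨hij, hW⟩, rfl⟩
    exact ⟨i, j, hij, (cliqueLabel_eq_iff hij).mpr hW, rfl⟩
  · rintro ⟨i, j, hij, hκ, rfl⟩
    exact ⟨i, j, ⟨hij, (cliqueLabel_eq_iff hij).mp hκ⟩, rfl⟩

lemma monomialIdeal_cliqueLabel (W : Set (Fin n)) :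
    monomialIdeal K ∅ (cliqueLabel W) = axesIdeal K (Sum.inl '' W) := by
  rw [monomialIdeal, varIdeal_empty, bot_sup_eq, axesIdeal]
  congr 1
  ext f
  constructor
  · rintro ⟨i, j, hij, hκ, rfl⟩
    have hW := (cliqueLabel_eq_iff hij).mp hκ
    exact ⟨_, ⟨i, hW.1, rfl⟩, _, ⟨j, hW.2, rfl⟩, fun h => hij (Sum.inl_injective h), rfl⟩
  · rintro ⟨_, ⟨i, hi, rfl⟩, _, ⟨j, hj, rfl⟩, hij, rfl⟩
    have hij' : i ≠ j := fun h => hij (congrArg _ h)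
    exact ⟨i, j, hij', (cliqueLabel_eq_iff hij').mpr ⟨hi, hj⟩, rfl⟩

variable {τ : MonomialOrder.{0, v} (Fin n ⊕ Fin n)}

theorem isGin_edgeIdeal_completeOn
    (hτ : ∀ i : Fin n, τ.toSyn (Finsupp.single (Sum.inr i) 1) <
      τ.toSyn (Finsupp.single (Sum.inl i) 1)) (W : Set (Fin n)) :
    IsGin τ (edgeIdeal K (completeOn W)) (axesIdeal K (Sum.inl '' W)) := by
  rw [edgeIdeal_completeOn, ← monomialIdeal_cliqueLabel]
  exact isGin_binomialIdeal hτ _ _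

theorem isGin_primeP
    (hτ : ∀ i : Fin n, τ.toSyn (Finsupp.single (Sum.inr i) 1) <
      τ.toSyn (Finsupp.single (Sum.inl i) 1)) (G : SimpleGraph (Fin n)) (S : Finset (Fin n)) :
    IsGin τ (primeP K G S) (monomialIdeal K S (componentLabel G S)) := by
  rw [primeP_eq_binomialIdeal]
  exact isGin_binomialIdeal hτ _ _

lemma span_mul_lt_eq_axesIdeal (t : ℕ) :
    Ideal.span {f | ∃ i j : Fin n, i < j ∧ j.val < t ∧ f = x K i * x K j} =
      axesIdeal K (Sum.inl '' {i : Fin n | i.val < t}) := by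
  rw [axesIdeal]
  congr 1
  ext f
  constructor
  · rintro ⟨i, j, hij, hj, rfl⟩
    exact ⟨_, ⟨i, lt_trans (Fin.lt_def.mp hij) hj, rfl⟩, _, ⟨j, hj, rfl⟩,
      fun h => hij.ne (Sum.inl_injective h), rfl⟩
  · rintro ⟨_, ⟨i, hi, rfl⟩, _, ⟨j, hj, rfl⟩, hij, rfl⟩
    rcases lt_trichotomy i j with h | h | h
    · exact ⟨i, j, h, hj, rfl⟩
    · exact absurd (congrArg _ h) hij
    · exact ⟨j, i, h, hi, mul_comm _ _⟩

lemma span_ne_eq_span_X_image (t : ℕ) (i : Fin n) :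
    Ideal.span {f | ∃ j : Fin n, j.val < t ∧ j ≠ i ∧ f = x K j} =
      Ideal.span (X '' (Sum.inl '' {i : Fin n | i.val < t} \ {Sum.inl i})) := by
  congr 1
  ext f
  constructor
  · rintro ⟨j, hj, hji, rfl⟩
    exact ⟨_, ⟨⟨j, hj, rfl⟩, fun h => hji (Sum.inl_injective h)⟩, rfl⟩
  · rintro ⟨_, ⟨⟨j, hj, rfl⟩, hji⟩, rfl⟩
    exact ⟨j, hj, fun h => hji (congrArg _ h), rfl⟩

end Cliques

end BinomialEdge

end

theorem mainTheorem11 {n : ℕ} {K : Type u} [Field K]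
    (τ : MonomialOrder.{0, v} (Fin n ⊕ Fin n))
    (hτ : ∀ i : Fin n, τ.toSyn (Finsupp.single (Sum.inr i) 1) <
      τ.toSyn (Finsupp.single (Sum.inl i) 1)) :
    (∀ (G : SimpleGraph (Fin n)) (S : Finset (Fin n)),
      BinomialEdge.IsGin τ (BinomialEdge.primeP K G S)
        (BinomialEdge.gin τ (BinomialEdge.primeP K G S)) ∧
      (∀ C : BinomialEdge.Component G S,
        BinomialEdge.IsGin τ
          (BinomialEdge.edgeIdeal K (BinomialEdge.completeOn (BinomialEdge.componentVerts C)))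
          (BinomialEdge.gin τ
            (BinomialEdge.edgeIdeal K
              (BinomialEdge.completeOn (BinomialEdge.componentVerts C))))) ∧
      BinomialEdge.gin τ (BinomialEdge.primeP K G S) =
        BinomialEdge.varIdeal K S ⊔
          ⨆ C : BinomialEdge.Component G S,
            BinomialEdge.gin τ
              (BinomialEdge.edgeIdeal K
                (BinomialEdge.completeOn (BinomialEdge.componentVerts C))) ∧
      BinomialEdge.IsSquarefreeMonomialIdeal
        (BinomialEdge.gin τ (BinomialEdge.primeP K G S)) ∧
      (BinomialEdge.gin τ (BinomialEdge.primeP K G S)).height +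
          (Nat.card (BinomialEdge.Component G S) : ℕ∞) = (n : ℕ∞) + (S.card : ℕ∞)) ∧
    (∀ t : ℕ, 1 ≤ t → t ≤ n →
      BinomialEdge.IsGin τ
        (BinomialEdge.edgeIdeal K (BinomialEdge.completeOn {i : Fin n | i.val < t}))
        (BinomialEdge.gin τ
          (BinomialEdge.edgeIdeal K (BinomialEdge.completeOn {i : Fin n | i.val < t}))) ∧
      BinomialEdge.gin τ
          (BinomialEdge.edgeIdeal K (BinomialEdge.completeOn {i : Fin n | i.val < t})) =
        Ideal.span {f | ∃ i j : Fin n, i < j ∧ j.val < t ∧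
          f = BinomialEdge.x K i * BinomialEdge.x K j} ∧
      Ideal.span {f | ∃ i j : Fin n, i < j ∧ j.val < t ∧
          f = BinomialEdge.x K i * BinomialEdge.x K j} =
        ⨅ i : {i : Fin n // i.val < t},
          Ideal.span {f | ∃ j : Fin n, j.val < t ∧ j ≠ i.1 ∧ f = BinomialEdge.x K j} ∧
      (∀ i : {i : Fin n // i.val < t},
        (Ideal.span {f | ∃ j : Fin n, j.val < t ∧ j ≠ i.1 ∧
          f = BinomialEdge.x K j}).IsPrime) ∧
      BinomialEdge.IsSquarefreeMonomialIdeal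
        (BinomialEdge.gin τ
          (BinomialEdge.edgeIdeal K (BinomialEdge.completeOn {i : Fin n | i.val < t}))) ∧
      BinomialEdge.IsCohenMacaulay
        (BinomialEdge.PolyRing n K ⧸ BinomialEdge.gin τ
          (BinomialEdge.edgeIdeal K
            (BinomialEdge.completeOn {i : Fin n | i.val < t})))) := by
  refine ⟨fun G S => ?_, fun t ht htn => ?_⟩
  · have hP := BinomialEdge.isGin_primeP (K := K) hτ G S
    have hC := fun C : BinomialEdge.Component G S =>
      BinomialEdge.isGin_edgeIdeal_completeOn (K := K) hτ (BinomialEdge.componentVerts C)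
    simp only [fun C => (hC C).gin_eq, hP.gin_eq]
    refine ⟨hP, hC, BinomialEdge.monomialIdeal_componentLabel G S,
      BinomialEdge.isSquarefreeMonomialIdeal_monomialIdeal K _ _, ?_⟩
    rw [← BinomialEdge.ncard_image_componentLabel]
    exact BinomialEdge.height_monomialIdeal
  · have hG := BinomialEdge.isGin_edgeIdeal_completeOn (K := K) hτ {i : Fin n | i.val < t}
    have hne : (Sum.inl '' {i : Fin n | i.val < t} : Set (Fin n ⊕ Fin n)).Nonempty :=
      ⟨_, ⟨0, by omega⟩, Nat.pos_of_ne_zero (by omega), rfl⟩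
    simp only [hG.gin_eq, BinomialEdge.span_mul_lt_eq_axesIdeal,
      BinomialEdge.span_ne_eq_span_X_image]
    refine ⟨hG, trivial, ?_, fun i => BinomialEdge.isPrime_span_X_image _, ?_,
      by rw [hG.gin_eq]; exact BinomialEdge.isCohenMacaulay_quotient_axesIdeal hne⟩
    · rw [BinomialEdge.axesIdeal_eq_iInf hne]
      refine le_antisymm (le_iInf fun i => iInf_le_of_le ⟨_, i, i.2, rfl⟩ le_rfl) (le_iInf ?_)
      rintro ⟨_, i, hi, rfl⟩
      exact iInf_le_of_le ⟨i, hi⟩ le_rfl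
    · rw [← BinomialEdge.monomialIdeal_cliqueLabel]
      exact BinomialEdge.isSquarefreeMonomialIdeal_monomialIdeal K _ _
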